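/- Let $\mathbb K\in\{\mathbb R,\mathbb C\}$ and set $\sigma_{\mathbb R}(d)=d$, $\sigma_{\mathbb C}(d)=2d$. Write $\log$ for the logarithm to base $2$ and $\mathbb N^*=\{1,2,\dots\}$. A \emph{decay rate function} with parameter $t^*\ge 0$ is an infinitely differentiable function $\psi:(0,\infty)\to\mathbb R$ such that $\psi((t^*,\infty))=(0,\infty)$ and $t\mapsto\psi(t)/t$ is non-decreasing on $(t^*,\infty)$; it restricts to a bijection $(t^*,\infty)\to(0,\infty)$, whose inverse is denoted $\psi^{(-1)}$. Its $\psi$-average and $\psi$-difference functions are $$\delta(d)=\frac1d\sum_{n=1}^d(\psi(d)-\psi(n))\quad(d\ge 1),\qquad \zeta(d)=\psi(d)-\psi(d-1)\quad(d\ge 2).$$ Let $p,q\in[1,\infty]$ (with $1/\infty=0$), let $\psi$ be a decay rate function, let $c_0>0$, and put $\mu_n=c_0\,2^{-\psi(n)}$ for $n\in\mathbb N^*$. Let $\mathcal E_p=\{x\in\ell^p(\mathbb N^*;\mathbb K):\|x\|_{p,\mu}\le 1\}$, where $\|x\|_{p,\mu}=\big(\sum_n|x_n/\mu_n|^p\big)^{1/p}$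 if $p<\infty$ and $\|x\|_{\infty,\mu}=\sup_n|x_n/\mu_n|$. For $\varepsilon>0$ let $N(\varepsilon;\mathcal E_p,\|\cdot\|_q)$ be the smallest number of closed $\|\cdot\|_q$-balls of radius $\varepsilon$, with centers in $\ell^q(\mathbb N^*;\mathbb K)$, that cover $\mathcal E_p$, and let $H(\varepsilon;\mathcal E_p,\|\cdot\|_q)=\log N(\varepsilon;\mathcal E_p,\|\cdot\|_q)$. Then $\mathcal E_p\subseteq\ell^q(\mathbb N^*;\mathbb K)$, $N(\varepsilon;\mathcal E_p,\|\cdot\|_q)$ is finite for every $\varepsilon>0$, and there is a function $\varepsilon\mapsto d_\varepsilon\in\mathbb N^*$ on $(0,\infty)$ with $$d_\varepsilon=\psi^{(-1)}\big[\log(\varepsilon^{-1})+\log(c_0)\big]+O(1)\quad\text{as }\varepsilon\to0$$ such that $$H(\varepsilon;\mathcal E_p,\|\cdot\|_q)=\sigma_{\mathbb K}(d_\varepsilon)\Big\{\delta(d_\varepsilon)+\Big(\frac1q-\frac1p\Big)\log\big(\sigma_{\mathbb K}(d_\varepsilon)\big)+O\big(\zeta(d_\varepsilon)\big)\Big\}\quad\text{as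 }\varepsilon\to0\ (\text{equivalently, as }d_\varepsilon\to\infty).$$ The implied constants may depend on $p,q,\psi,c_0,\mathbb K$. -/

import Mathlib

open scoped ENNReal NNReal Topology

noncomputable section

/-- The dimension over `ℝ` of `𝕜 ^ d`: it is `d` for `𝕜 = ℝ` and `2 * d` for `𝕜 = ℂ`. -/
def sigmaDim (𝕜 : Type*) [RCLike 𝕜] (d : ℕ) : ℕ :=
  Module.finrank ℝ 𝕜 * d

/-- `ψ : (0, ∞) → ℝ` is a decay rate function with parameter `tstar`
(the values of `ψ` outside `(0, ∞)` play no role). -/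
structure IsDecayRate (ψ : ℝ → ℝ) (tstar : ℝ) : Prop where
  nonneg : 0 ≤ tstar
  smooth : ContDiffOn ℝ ((⊤ : ℕ∞) : WithTop ℕ∞) ψ (Set.Ioi 0)
  image_eq : ψ '' Set.Ioi tstar = Set.Ioi 0
  monotoneOn_div : MonotoneOn (fun t : ℝ => ψ t / t) (Set.Ioi tstar)

/-- The inverse `(0, ∞) → (tstar, ∞)` of the restriction of `ψ` to `(tstar, ∞)`. -/
def decayInv (ψ : ℝ → ℝ) (tstar : ℝ) : ℝ → ℝ :=
  Function.invFunOn ψ (Set.Ioi tstar)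

/-- The restriction of a decay rate function to `(tstar, ∞)` is injective. -/
theorem IsDecayRate.injOn {ψ : ℝ → ℝ} {tstar : ℝ} (h : IsDecayRate ψ tstar) :
    Set.InjOn ψ (Set.Ioi tstar) := by
  have key : ∀ s ∈ Set.Ioi tstar, ∀ t ∈ Set.Ioi tstar, s < t → ψ s < ψ t := by
    intro s hs t ht hst
    have hs0 : 0 < s := lt_of_le_of_lt h.nonneg hs
    have ht0 : 0 < t := hs0.trans hst
    have hp : 0 < ψ s := by
      have : ψ s ∈ ψ '' Set.Ioi tstar := ⟨s, hs, rfl⟩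
      rw [h.image_eq] at this
      exact this
    have hm : ψ s / s ≤ ψ t / t := h.monotoneOn_div hs ht hst.le
    rw [div_le_div_iff₀ hs0 ht0] at hm
    nlinarith
  intro s hs t ht hst
  rcases lt_trichotomy s t with hlt | heq | hlt
  · exact absurd hst (key s hs t ht hlt).ne
  · exact heq
  · exact absurd hst (key t ht s hs hlt).ne'

/-- `decayInv ψ tstar` is the two-sided inverse of `ψ : (tstar, ∞) → (0, ∞)`. -/
theorem IsDecayRate.invOn_decayInv {ψ : ℝ → ℝ} {tstar : ℝ} (h : IsDecayRate ψ tstar) :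
    Set.InvOn (decayInv ψ tstar) ψ (Set.Ioi tstar) (Set.Ioi 0) := by
  refine ⟨h.injOn.leftInvOn_invFunOn, ?_⟩
  have hs : Set.SurjOn ψ (Set.Ioi tstar) (Set.Ioi 0) := h.image_eq.ge
  exact hs.rightInvOn_invFunOn

/-- The `ψ`-average function `δ(d) = (1/d) ∑_{n=1}^d (ψ(d) - ψ(n))`, for `d ≥ 1`. -/
def psiAverage (ψ : ℝ → ℝ) (d : ℕ) : ℝ :=
  (1 / (d : ℝ)) * ∑ n ∈ Finset.Icc 1 d, (ψ (d : ℝ) - ψ (n : ℝ))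

/-- The `ψ`-difference function `ζ(d) = ψ(d) - ψ(d-1)`, for `d ≥ 2`. -/
def psiDifference (ψ : ℝ → ℝ) (d : ℕ) : ℝ :=
  ψ (d : ℝ) - ψ ((d : ℝ) - 1)

/-- The `ψ`-exponentially decaying semi-axes `μ_n = c₀ exp(- ln 2 · ψ(n))`, for `n ≥ 1`. -/
def expSemiAxes (c₀ : ℝ) (ψ : ℝ → ℝ) (n : ℕ+) : ℝ :=
  c₀ * Real.exp (-(Real.log 2 * ψ (n : ℝ)))

/-- The `p`-ellipsoid norm of a sequence, with values in `[0, ∞]`. -/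
def ellipsoidNorm {𝕜 : Type*} [RCLike 𝕜] (p : ℝ≥0∞) (μ : ℕ+ → ℝ) (x : ℕ+ → 𝕜) : ℝ≥0∞ :=
  if p = ⊤ then ⨆ n, ‖x n / (μ n : 𝕜)‖ₑ
  else (∑' n, ‖x n / (μ n : 𝕜)‖ₑ ^ p.toReal) ^ (1 / p.toReal)

/-- The infinite-dimensional `p`-ellipsoid with semi-axes `μ`, a subset of `ℓ^p(ℕ*; 𝕜)`. -/
def ellipsoid (𝕜 : Type*) [RCLike 𝕜] (p : ℝ≥0∞) (μ : ℕ+ → ℝ) :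
    Set (lp (fun _ : ℕ+ => 𝕜) p) :=
  {x | ellipsoidNorm p μ (fun n => x n) ≤ 1}

/-- The set of all elements of `ℓ^q` that, as sequences, lie in the `p`-ellipsoid. It is a copy of
the whole ellipsoid as soon as the latter is contained in `ℓ^q`. -/
def ellipsoidIn (𝕜 : Type*) [RCLike 𝕜] (p q : ℝ≥0∞) (μ : ℕ+ → ℝ) :
    Set (lp (fun _ : ℕ+ => 𝕜) q) :=
  {y | ∃ x ∈ ellipsoid 𝕜 p μ, ∀ n, y n = x n}

/-- The metric entropy `H(ε; K, dist) = log₂ N(ε; K, dist)`, where `N(ε; K, dist)` is the smallest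
number of closed `ε`-balls, with centers anywhere in the ambient space, that cover `K`. It is
meaningful if that number is finite (and `K` is non-empty). -/
def metricEntropy {X : Type*} [PseudoMetricSpace X] (ε : ℝ) (K : Set X) : ℝ :=
  Real.logb 2 ((Metric.externalCoveringNumber ε.toNNReal K).toNat : ℝ)

end

/-! Only volumes up to factors `C ^ d` matter. By linear growth of `ψ`, the difference `ζ(d)` is
bounded below by some `c > 0` for large `d`, so an additive error `O(d)` in the entropy is absorbed
by `σ(d) O(ζ(d))`. The exact volumes of `ℓ^p`-balls (Gamma factors) are therefore not needed: on `d`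
coordinates the unit ball of `ℓ^p` contains the cube of half-side `d^(-1/p)` and is contained in an
`ℓ¹`-ball of radius `2d · d^(-1/p)`, whose volume exceeds that of the cube by at most `C ^ d`
(`exists_measureReal_setOf_sum_norm_div_le`).

Let `k` be the real dimension of the scalars. Lower bound: the `ε`-balls of a cover, projected to
the coordinates in `s`, must cover the box inside the ellipsoid
(`exists_prod_le_card_mul_of_isCover`). With `s = {1, ..., d}` and `L = log(c₀/ε)` this gives `H ≥ k
∑ (L - ψ(n) + (1/q - 1/p) log d) - O(d)`, where `∑ (L - ψ(n)) = d δ(d) - d (ψ(d) - L)`.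

Upper bound: around the points of a separated set lie disjoint boxes inside one slightly enlarged
`ℓ¹`-ball (`exists_card_mul_prod_le_of_isSeparated`). This needs the semi-axes outside `s` to have
sum at most `ε/4`, which holds for `s = {1, ..., d + m}` with `m` independent of `ε`, since the
tails decay geometrically. The cost of the extra `m` coordinates and of the enlargement is `O(d)`.

Finally `d = ⌈ψ⁻¹(L)⌉` gives `ψ(d-1) ≤ L ≤ ψ(d)`, so `ψ(d) - L ≤ ζ(d)`. -/

/-! ### Volumes of boxes and weighted `ℓ¹`-balls. -/

open MeasureTheory in
/-- Product boxes of balls have the expected volume. -/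
theorem measureReal_pi_univ_closedBall {E ι : Type*} [NormedAddCommGroup E] [NormedSpace ℝ E]
    [FiniteDimensional ℝ E] [MeasurableSpace E] [BorelSpace E] (ν : Measure E)
    [ν.IsAddHaarMeasure] [Fintype ι] (c : ι → E) {r : ι → ℝ} (hr : ∀ i, 0 ≤ r i) :
    (Measure.pi fun _ : ι => ν).real (Set.univ.pi fun i => Metric.closedBall (c i) (r i)) =
      ν.real (Metric.closedBall 0 1) ^ Fintype.card ι * ∏ i, r i ^ Module.finrank ℝ E := by
  have : ∀ i, ν.real (Metric.closedBall (c i) (r i)) =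
      ν.real (Metric.closedBall 0 1) * r i ^ Module.finrank ℝ E := fun i => by
    rw [Measure.addHaar_real_closedBall' ν _ (hr i), mul_comm]
  rw [measureReal_def, Measure.pi_pi, ENNReal.toReal_prod]
  simp only [← measureReal_def, this, Finset.prod_mul_distrib, Finset.prod_const,
    Finset.card_univ]

open MeasureTheory in
/-- A weighted `ℓ¹`-ball of radius proportional to the dimension `d` is, up to a factor `C ^ d`,
not larger than the box spanned by the weights. -/
theorem exists_measureReal_setOf_sum_norm_div_le {E : Type*} [NormedAddCommGroup E]
    [NormedSpace ℝ E] [FiniteDimensional ℝ E] [MeasurableSpace E] [BorelSpace E] (ν : Measure E)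
    [ν.IsAddHaarMeasure] (M : ℝ) :
    ∃ C : ℝ, 0 < C ∧ ∀ {ι : Type} [Fintype ι] (c : ι → E) (b : ι → ℝ), (∀ i, 0 < b i) →
      (Measure.pi fun _ : ι => ν) {x | ∑ i, ‖x i - c i‖ / b i ≤ M * Fintype.card ι} ≠ ⊤ ∧
      (Measure.pi fun _ : ι => ν).real {x | ∑ i, ‖x i - c i‖ / b i ≤ M * Fintype.card ι} ≤
        C ^ Fintype.card ι * ∏ i, b i ^ Module.finrank ℝ E := by
  set k := Module.finrank ℝ E
  -- An integrable weight. Since `1 + u ≤ exp u`, the product of its rescaled copies is at least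
  -- `exp(-(k+1) M d)` on the set, and Markov's inequality for the product integral bounds the
  -- volume.
  set g : E → ℝ := fun x => (1 + ‖x‖) ^ (-((k : ℝ) + 1)) with hg
  have hgint : Integrable g ν := integrable_one_add_norm (by linarith)
  have hg0 : ∀ x, 0 < g x := fun x => by positivity
  set I := ∫ x, g x ∂ν
  -- `I + 1` instead of `I` makes the constant positive without showing `I > 0`.
  refine ⟨Real.exp ((k + 1) * M) * (I + 1), ?_, fun {ι} _ c b hb => ?_⟩
  · have : 0 ≤ I := integral_nonneg fun x => (hg0 x).le
    positivity
  have hI : 0 ≤ I := integral_nonneg fun x => (hg0 x).le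
  refine ⟨?_, ?_⟩
  · refine ne_top_of_le_ne_top (b := (Measure.pi fun _ : ι => ν)
      (Set.univ.pi fun i => Metric.closedBall (c i) (b i * (M * Fintype.card ι)))) ?_ ?_
    · rw [Measure.pi_pi]
      exact ENNReal.prod_ne_top fun i _ => measure_closedBall_lt_top.ne
    · refine measure_mono fun x hx i _ => ?_
      rw [Metric.mem_closedBall, dist_eq_norm, ← div_le_iff₀' (hb i)]
      exact (Finset.single_le_sum (f := fun i => ‖x i - c i‖ / b i)
        (fun j _ => div_nonneg (norm_nonneg _) (hb j).le) (Finset.mem_univ i)).trans hx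
  · set f : ι → E → ℝ := fun i x => g ((b i)⁻¹ • (x - c i)) with hf
    have hfint : ∀ i, Integrable (f i) ν := fun i =>
      (hgint.comp_smul (inv_ne_zero (hb i).ne')).comp_sub_right (c i)
    have hfval : ∀ i, ∫ x, f i x ∂ν = b i ^ k * I := fun i => by
      rw [hf]
      simp only
      rw [integral_sub_right_eq_self (fun x => g ((b i)⁻¹ • x)) (c i),
        Measure.integral_comp_inv_smul_of_nonneg ν _ (hb i).le, smul_eq_mul]
    have hF : Integrable (fun x : ι → E => ∏ i, f i (x i)) (Measure.pi fun _ : ι => ν) :=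
      Integrable.fintype_prod hfint
    have hF0 : ∀ x : ι → E, 0 ≤ ∏ i, f i (x i) := fun x =>
      Finset.prod_nonneg fun i _ => (hg0 _).le
    set η := Real.exp (-((k + 1) * M) * Fintype.card ι) with hη
    have hsub : {x : ι → E | ∑ i, ‖x i - c i‖ / b i ≤ M * Fintype.card ι} ⊆
        {x | η ≤ ∏ i, f i (x i)} := by
      intro x hx
      have h1 : ∀ i, Real.exp (-((k : ℝ) + 1) * (‖x i - c i‖ / b i)) ≤ f i (x i) := fun i => by
        have hu : 0 ≤ ‖x i - c i‖ / b i := div_nonneg (norm_nonneg _) (hb i).le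
        have : f i (x i) = (1 + ‖x i - c i‖ / b i) ^ (-((k : ℝ) + 1)) := by
          simp only [hf, hg, norm_smul, norm_inv, Real.norm_eq_abs, abs_of_pos (hb i)]
          rw [div_eq_inv_mul]
        rw [this, mul_comm, Real.exp_mul]
        refine Real.rpow_le_rpow_of_nonpos (by positivity) ?_ (by linarith [k.cast_nonneg (α := ℝ)])
        linarith [Real.add_one_le_exp (‖x i - c i‖ / b i)]
      calc η ≤ Real.exp (∑ i, -((k : ℝ) + 1) * (‖x i - c i‖ / b i)) := by
            rw [hη, Real.exp_le_exp, ← Finset.mul_sum]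
            have : (0 : ℝ) ≤ k + 1 := by positivity
            nlinarith [mul_le_mul_of_nonneg_left (Set.mem_ofPred.mp hx) this]
        _ = ∏ i, Real.exp (-((k : ℝ) + 1) * (‖x i - c i‖ / b i)) := Real.exp_sum _ _
        _ ≤ _ := Finset.prod_le_prod (fun i _ => (Real.exp_pos _).le) fun i _ => h1 i
    have hη0 : 0 < η := Real.exp_pos _
    have hmark := mul_meas_ge_le_integral_of_nonneg (Filter.Eventually.of_forall hF0) hF η
    rw [integral_fintype_prod_eq_prod] at hmark
    simp only [hfval] at hmark
    rw [Finset.prod_mul_distrib, Finset.prod_const, Finset.card_univ] at hmark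
    have hle : (Measure.pi fun _ : ι => ν).real
        {x | ∑ i, ‖x i - c i‖ / b i ≤ M * Fintype.card ι} ≤
        (Measure.pi fun _ : ι => ν).real {x | η ≤ ∏ i, f i (x i)} :=
      measureReal_mono hsub (hF.measure_ge_lt_top hη0).ne
    have hηinv : Real.exp ((k + 1) * M) ^ Fintype.card ι * η = 1 := by
      rw [hη, ← Real.exp_nat_mul, ← Real.exp_add]
      convert Real.exp_zero using 2
      ring
    have hP : 0 ≤ ∏ i, b i ^ k := Finset.prod_nonneg fun i _ => pow_nonneg (hb i).le _
    calc _ ≤ _ := hle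
      _ = Real.exp ((k + 1) * M) ^ Fintype.card ι *
          (η * (Measure.pi fun _ : ι => ν).real {x | η ≤ ∏ i, f i (x i)}) := by
        rw [← mul_assoc, hηinv, one_mul]
      _ ≤ Real.exp ((k + 1) * M) ^ Fintype.card ι *
          ((∏ i, b i ^ k) * I ^ Fintype.card ι) := by gcongr
      _ ≤ Real.exp ((k + 1) * M) ^ Fintype.card ι *
          ((∏ i, b i ^ k) * (I + 1) ^ Fintype.card ι) := by gcongr; linarith
      _ = _ := by rw [mul_pow]; ring

/-! ### Finite-dimensional `ℓ^p`-balls between cubes and `ℓ¹`-balls. -/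

/-- The restriction to a finite index set `s` of a non-negative family lies in the unit ball of
`ℓ^p`. -/
def FinLpLeOne {α : Type*} (p : ℝ≥0∞) (s : Finset α) (u : α → ℝ) : Prop :=
  if p = ⊤ then ∀ n ∈ s, u n ≤ 1 else ∑ n ∈ s, u n ^ p.toReal ≤ 1

theorem one_le_toReal_of_fact {p : ℝ≥0∞} [hp : Fact (1 ≤ p)] (h : p ≠ ⊤) : 1 ≤ p.toReal := by
  simpa using ENNReal.toReal_mono h hp.out

theorem inv_toReal_le_one (p : ℝ≥0∞) [hp : Fact (1 ≤ p)] : (p⁻¹).toReal ≤ 1 := by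
  simpa using ENNReal.toReal_mono ENNReal.one_ne_top (ENNReal.inv_le_one.mpr hp.out)

/-- A cube of half-side `d ^ (-1/p)` is contained in the unit ball of `ℓ^p`. -/
theorem finLpLeOne_of_le {α : Type*} {p : ℝ≥0∞} [Fact (1 ≤ p)] {s : Finset α} {u : α → ℝ}
    (hu : ∀ n ∈ s, 0 ≤ u n) (h : ∀ n ∈ s, u n ≤ (s.card : ℝ) ^ (-(p⁻¹).toReal)) :
    FinLpLeOne p s u := by
  unfold FinLpLeOne
  split_ifs with hp
  · simpa [hp] using h
  · have hp1 := one_le_toReal_of_fact hp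
    have hp0 : p.toReal ≠ 0 := by positivity
    calc ∑ n ∈ s, u n ^ p.toReal ≤ ∑ n ∈ s, ((s.card : ℝ) ^ (-(p⁻¹).toReal)) ^ p.toReal :=
          Finset.sum_le_sum fun n hn => Real.rpow_le_rpow (hu n hn) (h n hn) (by positivity)
      _ = s.card * (s.card : ℝ)⁻¹ := by
          rw [Finset.sum_const, nsmul_eq_mul, ← Real.rpow_mul (by positivity), ENNReal.toReal_inv,
            neg_mul, inv_mul_cancel₀ hp0, Real.rpow_neg_one]
      _ ≤ 1 := mul_inv_le_one

/-- A weak form of Hölder's inequality on the unit ball of `ℓ^p`. -/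
theorem FinLpLeOne.sum_le {α : Type*} {p : ℝ≥0∞} [Fact (1 ≤ p)] {s : Finset α} {u : α → ℝ}
    (hu : ∀ n ∈ s, 0 ≤ u n) (h : FinLpLeOne p s u) :
    ∑ n ∈ s, u n ≤ 2 * s.card * (s.card : ℝ) ^ (-(p⁻¹).toReal) := by
  unfold FinLpLeOne at h
  split_ifs at h with hp
  · have : ∑ n ∈ s, u n ≤ s.card := by simpa using Finset.sum_le_sum h
    simp only [hp, ENNReal.inv_top, ENNReal.toReal_zero, neg_zero, Real.rpow_zero]
    linarith [s.card.cast_nonneg (α := ℝ)]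
  · rcases s.eq_empty_or_nonempty with rfl | hs
    · simp
    have hd : (0 : ℝ) < s.card := by exact_mod_cast hs.card_pos
    have hp1 := one_le_toReal_of_fact hp
    have hp0 : p.toReal ≠ 0 := by positivity
    rw [Real.rpow_neg hd.le, ← div_eq_mul_inv, le_div_iff₀ (by positivity), Finset.sum_mul]
    calc ∑ n ∈ s, u n * (s.card : ℝ) ^ (p⁻¹).toReal
        ≤ ∑ n ∈ s, (1 + s.card * u n ^ p.toReal) := by
          refine Finset.sum_le_sum fun n hn => ?_
          -- After rescaling, `v ≤ 1 + v ^ p` replaces Hölder's inequality at the cost of the factor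
          -- 2.
          set v := u n * (s.card : ℝ) ^ (p⁻¹).toReal with hv
          have hv0 : 0 ≤ v := mul_nonneg (hu n hn) (by positivity)
          have hvp : v ^ p.toReal = s.card * u n ^ p.toReal := by
            rw [hv, Real.mul_rpow (hu n hn) (by positivity), ← Real.rpow_mul hd.le,
              ENNReal.toReal_inv, inv_mul_cancel₀ hp0, Real.rpow_one, mul_comm]
          rw [← hvp]
          rcases le_total v 1 with h1 | h1
          · linarith [Real.rpow_nonneg hv0 p.toReal]
          · linarith [Real.self_le_rpow_of_one_le h1 hp1]
      _ = s.card + s.card * ∑ n ∈ s, u n ^ p.toReal := by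
          rw [Finset.sum_add_distrib, Finset.mul_sum]; simp
      _ ≤ 2 * s.card := by nlinarith

/-! ### Norm estimates in `ℓ^q` through finitely many coordinates. -/

section lp

variable {α : Type*} {𝕜 : Type*} [RCLike 𝕜] {q : ℝ≥0∞}

theorem finLpLeOne_of_norm_le [Fact (1 ≤ q)] (f : lp (fun _ : α => 𝕜) q) (s : Finset α) {r : ℝ} (hr : 0 < r)
    (hf : ‖f‖ ≤ r) : FinLpLeOne q s fun n => ‖f n‖ / r := by
  unfold FinLpLeOne
  split_ifs with hq
  · intro n _
    rw [div_le_one hr]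
    exact (lp.norm_apply_le_norm (by simp [hq]) f n).trans hf
  · have hq1 := one_le_toReal_of_fact hq
    have hq0 : 0 < q.toReal := by positivity
    calc ∑ n ∈ s, (‖f n‖ / r) ^ q.toReal = (∑ n ∈ s, ‖f n‖ ^ q.toReal) / r ^ q.toReal := by
          rw [Finset.sum_div]
          exact Finset.sum_congr rfl fun n _ => Real.div_rpow (norm_nonneg _) hr.le _
      _ ≤ 1 := by
          rw [div_le_one (by positivity)]
          exact (lp.sum_rpow_le_norm_rpow hq0 f s).trans
            (Real.rpow_le_rpow (norm_nonneg _) hf hq0.le)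

/-- The element of `ℓ^q` that agrees with `y` on `s` and vanishes elsewhere. -/
noncomputable def lpOfFinset (q : ℝ≥0∞) (s : Finset α) (y : α → 𝕜) : lp (fun _ : α => 𝕜) q :=
  ⟨Set.indicator (s : Set α) y, (memℓp_zero (s.finite_toSet.subset fun i hi => by
    by_contra h; exact hi (Set.indicator_of_notMem h y))).of_exponent_ge (zero_le)⟩

theorem lpOfFinset_apply (s : Finset α) (y : α → 𝕜) (n : α) :
    lpOfFinset q s y n = Set.indicator (s : Set α) y n := rfl

theorem norm_lpOfFinset_le [Fact (1 ≤ q)] {s : Finset α} {y : α → 𝕜} {r : ℝ} (hr : 0 < r)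
    (h : FinLpLeOne q s fun n => ‖y n‖ / r) : ‖lpOfFinset q s y‖ ≤ r := by
  classical
  unfold FinLpLeOne at h
  split_ifs at h with hq
  · subst hq
    refine lp.norm_le_of_forall_le hr.le fun n => ?_
    rw [lpOfFinset_apply]
    by_cases hn : n ∈ s
    · rw [Set.indicator_of_mem (by exact_mod_cast hn)]
      exact (div_le_one hr).mp (h n hn)
    · rw [Set.indicator_of_notMem (by exact_mod_cast hn), norm_zero]
      exact hr.le
  · have hq1 := one_le_toReal_of_fact hq
    have hq0 : 0 < q.toReal := by positivity
    refine lp.norm_le_of_tsum_le hq0 hr.le ?_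
    rw [tsum_eq_sum (s := s) fun n hn => by
      rw [lpOfFinset_apply, Set.indicator_of_notMem (by exact_mod_cast hn), norm_zero,
        Real.zero_rpow hq0.ne']]
    rw [← div_le_one (by positivity), Finset.sum_div]
    refine le_trans (Finset.sum_le_sum fun n hn => ?_) h
    rw [lpOfFinset_apply, Set.indicator_of_mem (by exact_mod_cast hn),
      ← Real.div_rpow (norm_nonneg _) hr.le]

/-- The `ℓ^q`-norm is dominated by the `ℓ^1`-norm. -/
theorem lp_norm_le_of_sum_norm_le [Fact (1 ≤ q)] (f : lp (fun _ : α => 𝕜) q) {τ : ℝ} (hτ : 0 ≤ τ)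
    (h : ∀ t : Finset α, ∑ n ∈ t, ‖f n‖ ≤ τ) : ‖f‖ ≤ τ := by
  have h1 : ∀ n, ‖f n‖ ≤ τ := fun n => by simpa using h {n}
  rcases eq_or_ne q ⊤ with rfl | hq
  · exact lp.norm_le_of_forall_le hτ h1
  · have hq1 := one_le_toReal_of_fact hq
    refine lp.norm_le_of_forall_sum_le (by positivity) hτ fun t => ?_
    -- Every coordinate is at most `τ`, so all but one factor of the `q`-th power can be replaced by
    -- `τ`.
    have key : ∀ x : ℝ, 0 ≤ x → x ^ q.toReal = x * x ^ (q.toReal - 1) := fun x hx => by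
      rw [← Real.rpow_one_add' hx (by linarith)]
      congr 1; ring
    calc ∑ n ∈ t, ‖f n‖ ^ q.toReal ≤ ∑ n ∈ t, ‖f n‖ * τ ^ (q.toReal - 1) := by
          refine Finset.sum_le_sum fun n _ => ?_
          rw [key _ (norm_nonneg _)]
          gcongr
          exact h1 n
      _ = (∑ n ∈ t, ‖f n‖) * τ ^ (q.toReal - 1) := (Finset.sum_mul _ _ _).symm
      _ ≤ τ * τ ^ (q.toReal - 1) := by gcongr; exact h t
      _ = _ := (key _ hτ).symm

/-- Splitting the norm into finitely many coordinates and a tail. -/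
theorem lp_norm_le_add [Fact (1 ≤ q)] (f : lp (fun _ : α => 𝕜) q) (s : Finset α) {r τ : ℝ} (hr : 0 < r)
    (hτ : 0 ≤ τ) (hs : ∀ n ∈ s, ‖f n‖ ≤ r * (s.card : ℝ) ^ (-(q⁻¹).toReal))
    (h : ∀ t : Finset α, Disjoint t s → ∑ n ∈ t, ‖f n‖ ≤ τ) : ‖f‖ ≤ r + τ := by
  classical
  have h1 : ‖lpOfFinset q s f‖ ≤ r := by
    refine norm_lpOfFinset_le hr (finLpLeOne_of_le (fun n _ => by positivity) fun n hn => ?_)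
    rw [div_le_iff₀' hr]
    exact hs n hn
  have h2 : ‖f - lpOfFinset q s f‖ ≤ τ := by
    refine lp_norm_le_of_sum_norm_le _ hτ fun t => ?_
    refine le_trans ?_ (h (t \ s) Finset.sdiff_disjoint)
    have h0 : ∀ n, ‖(f - lpOfFinset q s f) n‖ = if n ∈ s then 0 else ‖f n‖ := fun n => by
      rw [lp.coeFn_sub, Pi.sub_apply, lpOfFinset_apply, Set.indicator_apply]
      split_ifs with a b b <;> simp_all
    simp only [h0]
    rw [Finset.sum_ite, Finset.sum_const_zero, zero_add, Finset.sdiff_eq_filter]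
  calc ‖f‖ = ‖lpOfFinset q s f + (f - lpOfFinset q s f)‖ := by congr 1; abel
    _ ≤ _ := (norm_add_le _ _).trans (add_le_add h1 h2)

end lp

/-! ### Coordinates of points of the ellipsoid. -/

section ellipsoid

variable {𝕜 : Type*} [RCLike 𝕜] {p q : ℝ≥0∞} {μ : ℕ+ → ℝ}

theorem enorm_div_semiAxis (hμ : ∀ n, 0 < μ n) (x : 𝕜) (n : ℕ+) :
    ‖x / (μ n : 𝕜)‖ₑ = ENNReal.ofReal (‖x‖ / μ n) := by
  rw [← ofReal_norm, norm_div, RCLike.norm_ofReal, abs_of_pos (hμ n)]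

theorem finLpLeOne_of_ellipsoidNorm_le_one [Fact (1 ≤ p)] (hμ : ∀ n, 0 < μ n) {x : ℕ+ → 𝕜}
    (hx : ellipsoidNorm p μ x ≤ 1) (s : Finset ℕ+) : FinLpLeOne p s fun n => ‖x n‖ / μ n := by
  unfold ellipsoidNorm at hx
  unfold FinLpLeOne
  simp only [enorm_div_semiAxis hμ] at hx
  have h0 : ∀ n, 0 ≤ ‖x n‖ / μ n := fun n => div_nonneg (norm_nonneg _) (hμ n).le
  split_ifs at hx ⊢ with hp
  · intro n _
    exact ENNReal.ofReal_le_one.mp ((le_iSup _ n).trans hx)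
  · have hp1 := one_le_toReal_of_fact hp
    have hp0 : 0 < p.toReal := by positivity
    rw [one_div, ENNReal.rpow_inv_le_iff hp0, ENNReal.one_rpow] at hx
    rw [← ENNReal.ofReal_le_one, ENNReal.ofReal_sum_of_nonneg fun n _ => by
      have := h0 n; positivity]
    refine le_trans (Finset.sum_le_sum fun n _ => ?_) ((ENNReal.sum_le_tsum s).trans hx)
    rw [ENNReal.ofReal_rpow_of_nonneg (h0 n) hp0.le]

theorem norm_le_of_ellipsoidNorm_le_one [Fact (1 ≤ p)] (hμ : ∀ n, 0 < μ n) {x : ℕ+ → 𝕜}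
    (hx : ellipsoidNorm p μ x ≤ 1) (n : ℕ+) : ‖x n‖ ≤ μ n := by
  have h := finLpLeOne_of_ellipsoidNorm_le_one hμ hx {n}
  have h0 : 0 ≤ ‖x n‖ / μ n := div_nonneg (norm_nonneg _) (hμ n).le
  rw [← div_le_one (hμ n)]
  unfold FinLpLeOne at h
  split_ifs at h with hp
  · exact h n (by simp)
  · have hp1 := one_le_toReal_of_fact hp
    rw [Finset.sum_singleton] at h
    by_contra! hlt
    exact absurd h (not_le.mpr (Real.one_lt_rpow hlt (by positivity)))

theorem ellipsoidNorm_lpOfFinset_le_one [Fact (1 ≤ p)] (hμ : ∀ n, 0 < μ n) {s : Finset ℕ+} {y : ℕ+ → 𝕜}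
    (h : FinLpLeOne p s fun n => ‖y n‖ / μ n) :
    ellipsoidNorm p μ (fun n => lpOfFinset p s y n) ≤ 1 := by
  classical
  unfold FinLpLeOne at h
  unfold ellipsoidNorm
  simp only [enorm_div_semiAxis hμ, lpOfFinset_apply]
  have h0 : ∀ n, 0 ≤ ‖y n‖ / μ n := fun n => div_nonneg (norm_nonneg _) (hμ n).le
  split_ifs at h ⊢ with hp
  · refine iSup_le fun n => ENNReal.ofReal_le_one.mpr ?_
    by_cases hn : n ∈ s
    · rw [Set.indicator_of_mem (by exact_mod_cast hn)]
      exact h n hn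
    · rw [Set.indicator_of_notMem (by exact_mod_cast hn)]
      simp
  · have hp1 := one_le_toReal_of_fact hp
    have hp0 : 0 < p.toReal := by positivity
    rw [one_div, ENNReal.rpow_inv_le_iff hp0, ENNReal.one_rpow, tsum_eq_sum (s := s) fun n hn => by
      rw [Set.indicator_of_notMem (by exact_mod_cast hn)]; simp [hp0]]
    rw [← ENNReal.ofReal_le_one, ENNReal.ofReal_sum_of_nonneg fun n _ => by
      have := h0 n; positivity] at h
    refine le_trans (Finset.sum_le_sum fun n hn => ?_) h
    rw [Set.indicator_of_mem (by exact_mod_cast hn), ENNReal.ofReal_rpow_of_nonneg (h0 n) hp0.le]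

theorem lpOfFinset_mem_ellipsoidIn [Fact (1 ≤ p)] (hμ : ∀ n, 0 < μ n) {s : Finset ℕ+} {y : ℕ+ → 𝕜}
    (h : FinLpLeOne p s fun n => ‖y n‖ / μ n) :
    lpOfFinset q s y ∈ ellipsoidIn 𝕜 p q μ :=
  ⟨lpOfFinset p s y, ellipsoidNorm_lpOfFinset_le_one hμ h, fun _ => rfl⟩

theorem ellipsoidNorm_le_one_of_mem {y : lp (fun _ : ℕ+ => 𝕜) q} (hy : y ∈ ellipsoidIn 𝕜 p q μ) :
    ellipsoidNorm p μ (fun n => y n) ≤ 1 := by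
  obtain ⟨x, hx, hxy⟩ := hy
  simp only [hxy]
  exact hx

/-- The coordinates are dominated by the summable semi-axes, so the point lies in `ℓ¹` and hence in
every `ℓ^q`, whichever of `p` and `q` is larger. -/
theorem memℓp_of_mem_ellipsoid [Fact (1 ≤ p)] [Fact (1 ≤ q)] (hμ : ∀ n, 0 < μ n) (hsum : Summable μ)
    {x : lp (fun _ : ℕ+ => 𝕜) p} (hx : x ∈ ellipsoid 𝕜 p μ) : Memℓp (fun n => x n) q := by
  have h1 : Memℓp (fun n => x n) 1 := memℓp_gen <| by
    simpa using hsum.of_nonneg_of_le (fun n => norm_nonneg _)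
      (norm_le_of_ellipsoidNorm_le_one hμ hx)
  exact h1.of_exponent_ge Fact.out

end ellipsoid

/-! ### Volume comparison for covers and for separated sets. -/

/-- Volume comparison: a finite `ε`-cover of the ellipsoid yields a cover of a box in the
coordinates of `s` by translates of a weighted `ℓ¹`-ball. -/
theorem exists_prod_le_card_mul_of_isCover (𝕜 : Type*) [RCLike 𝕜] :
    ∃ V C : ℝ, 0 < V ∧ 0 < C ∧ ∀ (p q : ℝ≥0∞) [Fact (1 ≤ p)] [Fact (1 ≤ q)] (μ : ℕ+ → ℝ),
      (∀ n, 0 < μ n) → ∀ s : Finset ℕ+, s.Nonempty → ∀ ε : ℝ, 0 < ε →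
      ∀ T : Finset (lp (fun _ : ℕ+ => 𝕜) q),
      Metric.IsCover ε.toNNReal (ellipsoidIn 𝕜 p q μ) (T : Set (lp (fun _ : ℕ+ => 𝕜) q)) →
      V ^ s.card * ∏ n ∈ s, (μ n * (s.card : ℝ) ^ (-(p⁻¹).toReal)) ^ Module.finrank ℝ 𝕜 ≤
        T.card * (C ^ s.card *
          ∏ _n ∈ s, (ε * (s.card : ℝ) ^ (-(q⁻¹).toReal)) ^ Module.finrank ℝ 𝕜) := by
  classical
  borelize 𝕜
  set ν : MeasureTheory.Measure 𝕜 := MeasureTheory.Measure.addHaar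
  -- The radius factor 2 is the constant of `FinLpLeOne.sum_le`.
  obtain ⟨C, hC, hvol⟩ := exists_measureReal_setOf_sum_norm_div_le ν 2
  refine ⟨ν.real (Metric.closedBall 0 1), C, ?_, hC, ?_⟩
  · exact ENNReal.toReal_pos (Metric.measure_closedBall_pos ν 0 one_pos).ne'
      MeasureTheory.measure_closedBall_lt_top.ne
  intro p q _ _ μ hμ s hs ε hε T hT
  have hd : (0 : ℝ) < s.card := by exact_mod_cast hs.card_pos
  set wp := (s.card : ℝ) ^ (-(p⁻¹).toReal)
  set wq := (s.card : ℝ) ^ (-(q⁻¹).toReal)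
  have hwp : 0 < wp := by positivity
  have hwq : 0 < wq := by positivity
  set k := Module.finrank ℝ 𝕜
  set ρ := MeasureTheory.Measure.pi fun _ : s => ν
  set S : lp (fun _ : ℕ+ => 𝕜) q → Set (s → 𝕜) := fun c =>
    {x | ∑ i : s, ‖x i - c i‖ / (ε * wq) ≤ 2 * Fintype.card s} with hS
  have hbox := measureReal_pi_univ_closedBall ν (fun _ : s => (0 : 𝕜))
    (r := fun n => μ n * wp) (fun n => (mul_pos (hμ n) hwp).le)
  have hball := fun c : lp (fun _ : ℕ+ => 𝕜) q => hvol (fun i : s => c i)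
    (fun _ => ε * wq) (fun _ => mul_pos hε hwq)
  -- A point of the box, extended by zero, lies in the ellipsoid. The center covering it may be
  -- nonzero outside `s`, but only its coordinates in `s` are used.
  have hsub : (Set.univ.pi fun i : s => Metric.closedBall (0 : 𝕜) (μ i * wp)) ⊆
      ⋃ c ∈ T, S c := by
    intro y hy
    set y' : ℕ+ → 𝕜 := fun n => if h : n ∈ s then y ⟨n, h⟩ else 0 with hy'
    have hyn : ∀ i : s, y' i = y i := fun i => by simp [hy']
    have hmem : lpOfFinset q s y' ∈ ellipsoidIn 𝕜 p q μ := by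
      refine lpOfFinset_mem_ellipsoidIn hμ (finLpLeOne_of_le
        (fun n _ => div_nonneg (norm_nonneg _) (hμ n).le) fun n hn => ?_)
      rw [div_le_iff₀' (hμ n)]
      have := hy ⟨n, hn⟩ (Set.mem_univ _)
      rw [mem_closedBall_zero_iff] at this
      rw [hyn ⟨n, hn⟩]
      exact this
    obtain ⟨c, hcT, hc⟩ := hT hmem
    have hcd : ‖lpOfFinset q s y' - c‖ ≤ ε := by
      have : edist (lpOfFinset q s y') c ≤ (ε.toNNReal : ℝ≥0∞) := hc
      rwa [edist_dist, ← ENNReal.ofReal, ENNReal.ofReal_le_ofReal_iff hε.le,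
        dist_eq_norm] at this
    refine Set.mem_biUnion hcT ?_
    have h2 := (finLpLeOne_of_norm_le _ s hε hcd).sum_le
      (fun n _ => div_nonneg (norm_nonneg _) hε.le)
    have h3 : ∑ i : s, ‖y i - c i‖ / ε ≤ 2 * s.card * wq := by
      rw [← Finset.sum_coe_sort] at h2
      refine le_trans (le_of_eq (Finset.sum_congr rfl fun i _ => ?_)) h2
      rw [lp.coeFn_sub, Pi.sub_apply, lpOfFinset_apply, Set.indicator_of_mem (by simp), hyn]
    simp only [hS, Set.mem_ofPred_eq, Fintype.card_coe]
    have h4 : ∑ i : s, ‖y i - c i‖ / (ε * wq) = (∑ i : s, ‖y i - c i‖ / ε) / wq := by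
      rw [Finset.sum_div]
      exact Finset.sum_congr rfl fun i _ => by rw [div_div]
    rw [h4, div_le_iff₀ hwq]
    exact h3
  have hfin : ρ (⋃ c ∈ T, S c) ≠ ⊤ :=
    (MeasureTheory.measure_biUnion_lt_top T.finite_toSet
      fun c _ => (hball c).1.lt_top).ne
  have hprod : ∀ f : ℕ+ → ℝ, ∏ i : s, f i = ∏ n ∈ s, f n := fun f => Finset.prod_coe_sort s f
  calc _ = ρ.real (Set.univ.pi fun i : s => Metric.closedBall (0 : 𝕜) (μ i * wp)) := by
        rw [hbox, Fintype.card_coe, hprod fun n => (μ n * wp) ^ k]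
    _ ≤ ρ.real (⋃ c ∈ T, S c) := MeasureTheory.measureReal_mono hsub hfin
    _ ≤ ∑ c ∈ T, ρ.real (S c) := MeasureTheory.measureReal_biUnion_finset_le T S
    _ ≤ ∑ _c ∈ T, (C ^ s.card * ∏ _n ∈ s, (ε * wq) ^ k) := by
        refine Finset.sum_le_sum fun c _ => ?_
        have := (hball c).2
        rw [hprod fun _ => (ε * wq) ^ k] at this
        rw [Fintype.card_coe] at this
        simp only [hS, Fintype.card_coe]
        exact this
    _ = _ := by rw [Finset.sum_const, nsmul_eq_mul]

/-- Volume comparison: around the points of a separated subset of the ellipsoid there are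
disjoint boxes, all contained in one weighted `ℓ¹`-ball. -/
theorem exists_card_mul_prod_le_of_isSeparated (𝕜 : Type*) [RCLike 𝕜] :
    ∃ V C : ℝ, 0 < V ∧ 0 < C ∧ ∀ (p q : ℝ≥0∞) [Fact (1 ≤ p)] [Fact (1 ≤ q)] (μ : ℕ+ → ℝ),
      (∀ n, 0 < μ n) → ∀ s : Finset ℕ+, s.Nonempty → ∀ ε : ℝ, 0 < ε →
      (∀ t : Finset ℕ+, Disjoint t s → ∑ n ∈ t, μ n ≤ ε) →
      ∀ T : Finset (lp (fun _ : ℕ+ => 𝕜) q), (T : Set _) ⊆ ellipsoidIn 𝕜 p q μ →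
      (∀ x ∈ T, ∀ y ∈ T, x ≠ y → 4 * ε < ‖x - y‖) →
      T.card * (V ^ s.card *
          ∏ _n ∈ s, (ε * (s.card : ℝ) ^ (-(q⁻¹).toReal)) ^ Module.finrank ℝ 𝕜) ≤
        C ^ s.card * ∏ n ∈ s, (μ n * (s.card : ℝ) ^ (-(p⁻¹).toReal) +
          ε * (s.card : ℝ) ^ (-(q⁻¹).toReal)) ^ Module.finrank ℝ 𝕜 := by
  classical
  borelize 𝕜
  set ν : MeasureTheory.Measure 𝕜 := MeasureTheory.Measure.addHaar
  -- `3 = 2 + 1`: the point of the ellipsoid contributes `2d` to the weighted sum, the box around it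
  -- `d`.
  obtain ⟨C, hC, hvol⟩ := exists_measureReal_setOf_sum_norm_div_le ν 3
  refine ⟨ν.real (Metric.closedBall 0 1), C, ?_, hC, ?_⟩
  · exact ENNReal.toReal_pos (Metric.measure_closedBall_pos ν 0 one_pos).ne'
      MeasureTheory.measure_closedBall_lt_top.ne
  intro p q _ _ μ hμ s hs ε hε htail T hTK hT
  have hd : (0 : ℝ) < s.card := by exact_mod_cast hs.card_pos
  set wp := (s.card : ℝ) ^ (-(p⁻¹).toReal)
  set wq := (s.card : ℝ) ^ (-(q⁻¹).toReal)
  have hwp : 0 < wp := by positivity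
  have hwq : 0 < wq := by positivity
  set k := Module.finrank ℝ 𝕜
  set ρ := MeasureTheory.Measure.pi fun _ : s => ν
  set B : lp (fun _ : ℕ+ => 𝕜) q → Set (s → 𝕜) := fun x =>
    Set.univ.pi fun i : s => Metric.closedBall (x i) (ε * wq) with hB
  have hbox := fun x : lp (fun _ : ℕ+ => 𝕜) q =>
    measureReal_pi_univ_closedBall ν (fun i : s => x i)
    (r := fun _ => ε * wq) (fun _ => (mul_pos hε hwq).le)
  obtain ⟨hfin, hball⟩ := hvol (fun _ : s => (0 : 𝕜)) (fun i => μ i * wp + ε * wq)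
    (fun i => add_pos (mul_pos (hμ i) hwp) (mul_pos hε hwq))
  have hprod : ∀ f : ℕ+ → ℝ, ∏ i : s, f i = ∏ n ∈ s, f n := fun f => Finset.prod_coe_sort s f
  have hsub : (⋃ x ∈ T, B x) ⊆
      {x | ∑ i : s, ‖x i - 0‖ / (μ i * wp + ε * wq) ≤ 3 * Fintype.card s} := by
    intro y hy
    simp only [Set.mem_iUnion] at hy
    obtain ⟨x, hxT, hyx⟩ := hy
    have hx := (finLpLeOne_of_ellipsoidNorm_le_one hμ
      (ellipsoidNorm_le_one_of_mem (hTK hxT)) s).sum_le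
        (fun n _ => div_nonneg (norm_nonneg _) (hμ n).le)
    rw [← Finset.sum_coe_sort] at hx
    simp only [Set.mem_ofPred_eq, Fintype.card_coe, sub_zero]
    calc ∑ i : s, ‖y i‖ / (μ i * wp + ε * wq) ≤ ∑ i : s, (‖x i‖ / μ i / wp + 1) := by
          refine Finset.sum_le_sum fun i _ => ?_
          have h1 : ‖y i‖ ≤ ‖x i‖ + ε * wq := by
            have h2 : dist (y i) (x i) ≤ ε * wq := hyx i (Set.mem_univ _)
            rw [dist_eq_norm] at h2
            linarith [norm_le_norm_add_norm_sub' (y i) (x i)]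
          have hμw := mul_pos (hμ i) hwp
          have hεw := mul_pos hε hwq
          rw [div_le_iff₀ (by positivity), div_div]
          refine h1.trans ?_
          have h3 : ‖x i‖ = ‖x i‖ / (μ i * wp) * (μ i * wp) :=
            (div_mul_cancel₀ _ hμw.ne').symm
          have h4 : 0 ≤ ‖x i‖ / (μ i * wp) := by positivity
          nlinarith
      _ = (∑ i : s, ‖x i‖ / μ i) / wp + s.card := by
          rw [Finset.sum_add_distrib, Finset.sum_div]; simp
      _ ≤ 2 * s.card + s.card := by
          gcongr
          rw [div_le_iff₀ hwp]
          exact hx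
      _ = _ := by ring
  -- If two boxes meet, their centers differ by at most `2ε` in the coordinates of `s` and by at
  -- most `2ε` in the tail, against the `4ε`-separation.
  have hdisj : Set.PairwiseDisjoint (T : Set (lp (fun _ : ℕ+ => 𝕜) q)) B := by
    intro x hx x' hx' hne
    refine Set.disjoint_left.mpr fun y hy hy' => ?_
    refine absurd (hT x hx x' hx' hne) (not_lt.mpr ?_)
    have := lp_norm_le_add (x - x') s (r := 2 * ε) (τ := 2 * ε) (by positivity) (by positivity)
      (fun n hn => ?_) (fun t ht => ?_)
    · linarith
    · have h1 : dist (y ⟨n, hn⟩) (x n) ≤ ε * wq := hy ⟨n, hn⟩ (Set.mem_univ _)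
      have h2 : dist (y ⟨n, hn⟩) (x' n) ≤ ε * wq := hy' ⟨n, hn⟩ (Set.mem_univ _)
      rw [lp.coeFn_sub, Pi.sub_apply, ← dist_eq_norm]
      linarith [dist_triangle_left (x n) (x' n) (y ⟨n, hn⟩)]
    · have hμx := norm_le_of_ellipsoidNorm_le_one hμ (ellipsoidNorm_le_one_of_mem (hTK hx))
      have hμx' := norm_le_of_ellipsoidNorm_le_one hμ (ellipsoidNorm_le_one_of_mem (hTK hx'))
      calc ∑ n ∈ t, ‖(x - x') n‖ ≤ ∑ n ∈ t, (2 * μ n) := by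
            refine Finset.sum_le_sum fun n _ => ?_
            rw [lp.coeFn_sub, Pi.sub_apply]
            linarith [norm_sub_le (x n) (x' n), hμx n, hμx' n]
        _ ≤ 2 * ε := by
            rw [← Finset.mul_sum]
            linarith [htail t ht]
  have hmeas : ∀ x ∈ T, MeasurableSet (B x) := fun x _ =>
    MeasurableSet.univ_pi fun _ => Metric.isClosed_closedBall.measurableSet
  calc _ = ∑ x ∈ T, ρ.real (B x) := by
        simp only [hB, ρ, hbox, Finset.sum_const, nsmul_eq_mul]
        rw [hprod fun _ => (ε * wq) ^ k, Fintype.card_coe]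
    _ = ρ.real (⋃ x ∈ T, B x) := by
        rw [MeasureTheory.measureReal_biUnion_finset hdisj hmeas fun x _ => ?_]
        rw [MeasureTheory.Measure.pi_pi]
        exact ENNReal.prod_ne_top fun i _ => MeasureTheory.measure_closedBall_lt_top.ne
    _ ≤ _ := MeasureTheory.measureReal_mono hsub hfin
    _ ≤ _ := by
        refine hball.trans (le_of_eq ?_)
        rw [hprod fun n => (μ n * wp + ε * wq) ^ k, Fintype.card_coe]

/-! ### From volume comparison to entropy bounds. -/

theorem finrank_real_rclike_pos (𝕜 : Type*) [RCLike 𝕜] : 0 < Module.finrank ℝ 𝕜 :=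
  Module.finrank_pos

theorem zero_mem_ellipsoidIn {𝕜 : Type*} [RCLike 𝕜] {p q : ℝ≥0∞} [Fact (1 ≤ p)] {μ : ℕ+ → ℝ}
    (hμ : ∀ n, 0 < μ n) : lpOfFinset q ∅ 0 ∈ ellipsoidIn 𝕜 p q μ :=
  lpOfFinset_mem_ellipsoidIn hμ (by unfold FinLpLeOne; split_ifs <;> simp)

/-- A finite external covering number is attained by a finite cover. -/
theorem exists_finset_isCover_card_le {X : Type*} [PseudoEMetricSpace X] {ε : ℝ≥0} {A : Set X}
    (h : Metric.externalCoveringNumber ε A ≠ ⊤) :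
    ∃ T : Finset X, Metric.IsCover ε A (T : Set X) ∧
      T.card ≤ (Metric.externalCoveringNumber ε A).toNat := by
  -- A cover of size below the infimum plus one attains the infimum.
  have h1 : Metric.externalCoveringNumber ε A < Metric.externalCoveringNumber ε A + 1 :=
    ENat.lt_add_one_iff h |>.mpr le_rfl
  nth_rewrite 1 [Metric.externalCoveringNumber] at h1
  simp only [iInf_lt_iff] at h1
  obtain ⟨C, hC, hlt⟩ := h1
  have hle : C.encard ≤ Metric.externalCoveringNumber ε A := (ENat.lt_add_one_iff h).mp hlt
  have hfin : C.Finite := Set.encard_ne_top_iff.mp (ne_top_of_le_ne_top h hle)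
  refine ⟨hfin.toFinset, by simpa using hC, ?_⟩
  rw [← Set.ncard_eq_toFinset_card C hfin]
  exact ENat.toNat_le_toNat hle h

/-- A uniform bound for the size of finite separated subsets bounds the covering number. -/
theorem externalCoveringNumber_le_of_forall_card_le {X : Type*} [PseudoEMetricSpace X] {ε : ℝ≥0}
    {A : Set X} {m : ℕ} (h : ∀ T : Finset X, (T : Set X) ⊆ A →
      Metric.IsSeparated (ε : ℝ≥0∞) (T : Set X) → T.card ≤ m) :
    Metric.externalCoveringNumber ε A ≤ m := by
  refine (Metric.externalCoveringNumber_le_coveringNumber ε A).trans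
    ((Metric.coveringNumber_le_packingNumber ε A).trans ?_)
  refine iSup_le fun C => iSup_le fun hCA => iSup_le fun hC => ?_
  by_contra! hlt
  have h1 : ((m + 1 : ℕ) : ℕ∞) ≤ C.encard := by
    push_cast
    exact Order.add_one_le_of_lt hlt
  obtain ⟨T, hTC, hT⟩ := Set.exists_subset_encard_eq h1
  have hfin : T.Finite := Set.finite_of_encard_eq_coe hT
  have h2 := h hfin.toFinset (by simpa using hTC.trans hCA) (by simpa using hC.subset hTC)
  rw [hfin.encard_eq_coe_toFinset_card] at hT
  have h3 : hfin.toFinset.card = m + 1 := by exact_mod_cast hT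
  omega

theorem logb_pow_card_mul_prod_pow {α : Type*} (s : Finset α) {V : ℝ} (hV : 0 < V) {f : α → ℝ}
    (hf : ∀ n ∈ s, 0 < f n) (k : ℕ) :
    Real.logb 2 (V ^ s.card * ∏ n ∈ s, f n ^ k) =
      s.card * Real.logb 2 V + k * ∑ n ∈ s, Real.logb 2 (f n) := by
  rw [Real.logb_mul (by positivity) (Finset.prod_pos fun n hn => pow_pos (hf n hn) k).ne',
    Real.logb_pow, Real.logb_prod _ _ fun n hn => (pow_pos (hf n hn) k).ne', Finset.mul_sum]
  simp only [Real.logb_pow]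

/-- Lower bound for the metric entropy in terms of finitely many semi-axes. -/
theorem exists_le_metricEntropy (𝕜 : Type*) [RCLike 𝕜] :
    ∃ C : ℝ, ∀ (p q : ℝ≥0∞) [Fact (1 ≤ p)] [Fact (1 ≤ q)] (μ : ℕ+ → ℝ),
      (∀ n, 0 < μ n) → ∀ s : Finset ℕ+, s.Nonempty → ∀ ε : ℝ, 0 < ε →
      Metric.externalCoveringNumber ε.toNNReal (ellipsoidIn 𝕜 p q μ) ≠ ⊤ →
      (Module.finrank ℝ 𝕜 : ℝ) * ∑ n ∈ s, (Real.logb 2 (μ n / ε) +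
        ((q⁻¹).toReal - (p⁻¹).toReal) * Real.logb 2 s.card) - C * s.card ≤
        metricEntropy ε (ellipsoidIn 𝕜 p q μ) := by
  obtain ⟨V, C, hV, hC, h⟩ := exists_prod_le_card_mul_of_isCover 𝕜
  refine ⟨Real.logb 2 C - Real.logb 2 V, fun p q _ _ μ hμ s hs ε hε htop => ?_⟩
  -- Finiteness is essential here: `toNat` sends an infinite covering number to 0.
  obtain ⟨T, hT, hcard⟩ := exists_finset_isCover_card_le htop
  have hd : (0 : ℝ) < s.card := by exact_mod_cast hs.card_pos
  have hTne : T.Nonempty := by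
    have := hT.nonempty ⟨_, zero_mem_ellipsoidIn hμ⟩
    simpa using this
  have hTpos : (0 : ℝ) < T.card := by exact_mod_cast hTne.card_pos
  have hm := h p q μ hμ s hs ε hε T hT
  set wp := (s.card : ℝ) ^ (-(p⁻¹).toReal) with hwp
  set wq := (s.card : ℝ) ^ (-(q⁻¹).toReal) with hwq
  have hwp0 : 0 < wp := by positivity
  have hwq0 : 0 < wq := by positivity
  have h1 : ∀ n ∈ s, 0 < μ n * wp := fun n _ => mul_pos (hμ n) hwp0
  have h2 : ∀ n ∈ s, 0 < ε * wq := fun n _ => mul_pos hε hwq0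
  have h3 : Real.logb 2 T.card ≤ metricEntropy ε (ellipsoidIn 𝕜 p q μ) :=
    Real.logb_le_logb_of_le one_lt_two hTpos (by exact_mod_cast hcard)
  have h4 := Real.logb_le_logb_of_le one_lt_two
    (mul_pos (pow_pos hV _) (Finset.prod_pos fun n hn => pow_pos (h1 n hn) _)) hm
  rw [Real.logb_mul hTpos.ne' (mul_pos (pow_pos hC _)
    (Finset.prod_pos fun n hn => pow_pos (h2 n hn) _)).ne',
    logb_pow_card_mul_prod_pow s hV h1, logb_pow_card_mul_prod_pow s hC h2] at h4
  have h5 : ∑ n ∈ s, (Real.logb 2 (μ n / ε) +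
        ((q⁻¹).toReal - (p⁻¹).toReal) * Real.logb 2 s.card) =
      ∑ n ∈ s, Real.logb 2 (μ n * wp) - ∑ n ∈ s, Real.logb 2 (ε * wq) := by
    rw [← Finset.sum_sub_distrib]
    refine Finset.sum_congr rfl fun n _ => ?_
    rw [Real.logb_div (hμ n).ne' hε.ne', Real.logb_mul (hμ n).ne' hwp0.ne',
      Real.logb_mul hε.ne' hwq0.ne', hwp, hwq, Real.logb_rpow_eq_mul_logb_of_pos hd,
      Real.logb_rpow_eq_mul_logb_of_pos hd]
    ring
  rw [h5]
  linarith

/-- Upper bound for the metric entropy in terms of finitely many semi-axes, provided that the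
remaining ones are small. -/
theorem exists_metricEntropy_le (𝕜 : Type*) [RCLike 𝕜] :
    ∃ C : ℝ, ∀ (p q : ℝ≥0∞) [Fact (1 ≤ p)] [Fact (1 ≤ q)] (μ : ℕ+ → ℝ),
      (∀ n, 0 < μ n) → ∀ s : Finset ℕ+, s.Nonempty → ∀ ε : ℝ, 0 < ε →
      (∀ t : Finset ℕ+, Disjoint t s → ∑ n ∈ t, μ n ≤ ε / 4) →
      Metric.externalCoveringNumber ε.toNNReal (ellipsoidIn 𝕜 p q μ) ≠ ⊤ ∧
      metricEntropy ε (ellipsoidIn 𝕜 p q μ) ≤ (Module.finrank ℝ 𝕜 : ℝ) *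
        ∑ n ∈ s, (Real.logb 2 (4 * (μ n / ε) +
          (s.card : ℝ) ^ ((p⁻¹).toReal - (q⁻¹).toReal)) +
        ((q⁻¹).toReal - (p⁻¹).toReal) * Real.logb 2 s.card) + C * s.card := by
  obtain ⟨V, C, hV, hC, h⟩ := exists_card_mul_prod_le_of_isSeparated 𝕜
  refine ⟨Real.logb 2 C - Real.logb 2 V, fun p q _ _ μ hμ s hs ε hε htail => ?_⟩
  have hd : (0 : ℝ) < s.card := by exact_mod_cast hs.card_pos
  have hε4 : 0 < ε / 4 := by positivity
  -- At scale `ε / 4` the required separation `4 * (ε / 4)` is exactly that of an `ε`-separated set.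
  have hm := h p q μ hμ s hs (ε / 4) hε4 htail
  set wp := (s.card : ℝ) ^ (-(p⁻¹).toReal) with hwp
  set wq := (s.card : ℝ) ^ (-(q⁻¹).toReal) with hwq
  have hwp0 : 0 < wp := by positivity
  have hwq0 : 0 < wq := by positivity
  set k := Module.finrank ℝ 𝕜
  have h1 : ∀ n ∈ s, 0 < μ n * wp + ε / 4 * wq := fun n _ =>
    add_pos (mul_pos (hμ n) hwp0) (mul_pos hε4 hwq0)
  have h2 : ∀ n ∈ s, 0 < ε / 4 * wq := fun n _ => mul_pos hε4 hwq0
  set P := C ^ s.card * ∏ n ∈ s, (μ n * wp + ε / 4 * wq) ^ k with hP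
  set Q := V ^ s.card * ∏ _n ∈ s, (ε / 4 * wq) ^ k with hQ
  have hP0 : 0 < P := mul_pos (pow_pos hC _) (Finset.prod_pos fun n hn => pow_pos (h1 n hn) _)
  have hQ0 : 0 < Q := mul_pos (pow_pos hV _) (Finset.prod_pos fun n hn => pow_pos (h2 n hn) _)
  have hN : Metric.externalCoveringNumber ε.toNNReal (ellipsoidIn 𝕜 p q μ) ≤ ⌊P / Q⌋₊ := by
    refine externalCoveringNumber_le_of_forall_card_le fun T hTK hT => ?_
    rw [Nat.le_floor_iff (by positivity), le_div_iff₀ hQ0]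
    refine hm T hTK fun x hx y hy hne => ?_
    have h3 : (ε.toNNReal : ℝ≥0∞) < edist x y := hT hx hy hne
    rw [edist_dist, ← ENNReal.ofReal, ENNReal.ofReal_lt_ofReal_iff_of_nonneg hε.le,
      dist_eq_norm] at h3
    linarith
  have htop := ne_top_of_le_ne_top (ENat.natCast_ne_top _) hN
  refine ⟨htop, ?_⟩
  have hpos : (0 : ℝ) <
      (Metric.externalCoveringNumber ε.toNNReal (ellipsoidIn 𝕜 p q μ)).toNat := by
    have : Metric.externalCoveringNumber ε.toNNReal (ellipsoidIn 𝕜 p q μ) ≠ 0 := by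
      rw [← pos_iff_ne_zero, Metric.externalCoveringNumber_pos_iff]
      exact ⟨_, zero_mem_ellipsoidIn hμ⟩
    have h3 : (Metric.externalCoveringNumber ε.toNNReal (ellipsoidIn 𝕜 p q μ)).toNat ≠ 0 := by
      rw [Ne, ENat.toNat_eq_zero]
      tauto
    exact_mod_cast Nat.pos_of_ne_zero h3
  have hle : ((Metric.externalCoveringNumber ε.toNNReal (ellipsoidIn 𝕜 p q μ)).toNat : ℝ) ≤
      P / Q := by
    refine le_trans ?_ (Nat.floor_le (by positivity : 0 ≤ P / Q))
    exact_mod_cast ENat.toNat_le_of_le_natCast hN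
  have h4 := Real.logb_le_logb_of_le one_lt_two hpos hle
  rw [Real.logb_div hP0.ne' hQ0.ne', hP, hQ, logb_pow_card_mul_prod_pow s hV h2,
    logb_pow_card_mul_prod_pow s hC h1] at h4
  have h5 : ∑ n ∈ s, (Real.logb 2 (4 * (μ n / ε) +
          (s.card : ℝ) ^ ((p⁻¹).toReal - (q⁻¹).toReal)) +
        ((q⁻¹).toReal - (p⁻¹).toReal) * Real.logb 2 s.card) =
      ∑ n ∈ s, Real.logb 2 (μ n * wp + ε / 4 * wq) - ∑ n ∈ s, Real.logb 2 (ε / 4 * wq) := by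
    rw [← Finset.sum_sub_distrib]
    refine Finset.sum_congr rfl fun n hn => ?_
    have hμε : 0 < 4 * (μ n / ε) := mul_pos four_pos (div_pos (hμ n) hε)
    rw [← Real.logb_rpow_eq_mul_logb_of_pos hd, ← Real.logb_mul (by positivity) (by positivity),
      ← Real.logb_div (h1 n hn).ne' (h2 n hn).ne']
    congr 1
    have hwpq : (s.card : ℝ) ^ ((q⁻¹).toReal - (p⁻¹).toReal) = wp / wq := by
      rw [hwp, hwq, ← Real.rpow_sub hd]
      congr 1; ring
    have hwqp : (s.card : ℝ) ^ ((p⁻¹).toReal - (q⁻¹).toReal) = wq / wp := by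
      rw [hwp, hwq, ← Real.rpow_sub hd]
      congr 1; ring
    rw [hwpq, hwqp]
    field_simp
  rw [h5]
  have h6 : metricEntropy ε (ellipsoidIn 𝕜 p q μ) =
    Real.logb 2 (Metric.externalCoveringNumber ε.toNNReal (ellipsoidIn 𝕜 p q μ)).toNat := rfl
  rw [h6]
  linarith

/-! ### Growth of decay rate functions. -/

namespace IsDecayRate

variable {ψ : ℝ → ℝ} {tstar : ℝ}

theorem pos_of_lt (h : IsDecayRate ψ tstar) {t : ℝ} (ht : tstar < t) : 0 < ψ t := by
  have : ψ t ∈ ψ '' Set.Ioi tstar := ⟨t, ht, rfl⟩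
  rwa [h.image_eq] at this

/-- Monotonicity of `ψ(t)/t` gives `ψ(t) ≥ (ψ(s)/s) t`, hence `ψ(t) - ψ(s) ≥ (ψ(s)/s)(t - s)`, and
`ψ(s)/s ≥ ψ(a)/a`. -/
theorem slope_mul_le_sub (h : IsDecayRate ψ tstar) {a s t : ℝ} (ha : tstar < a) (has : a ≤ s)
    (hst : s ≤ t) : ψ a / a * (t - s) ≤ ψ t - ψ s := by
  have ha0 : 0 < a := h.nonneg.trans_lt ha
  have hs0 : 0 < s := ha0.trans_le has
  have ht0 : 0 < t := hs0.trans_le hst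
  have h1 : ψ a / a ≤ ψ s / s := h.monotoneOn_div ha (ha.trans_le has) has
  have h2 : ψ s / s ≤ ψ t / t :=
    h.monotoneOn_div (ha.trans_le has) (ha.trans_le (has.trans hst)) hst
  have h3 : ψ t = ψ t / t * t := (div_mul_cancel₀ _ ht0.ne').symm
  have h4 : ψ s = ψ s / s * s := (div_mul_cancel₀ _ hs0.ne').symm
  rw [h3, h4]
  nlinarith [mul_le_mul_of_nonneg_right h2 ht0.le,
    mul_le_mul_of_nonneg_right h1 (sub_nonneg.mpr hst)]

theorem strictMonoOn (h : IsDecayRate ψ tstar) : StrictMonoOn ψ (Set.Ioi tstar) := by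
  intro s hs t _ hst
  have h1 := h.slope_mul_le_sub hs le_rfl hst.le
  have h2 : 0 < ψ s / s := div_pos (h.pos_of_lt hs) (h.nonneg.trans_lt hs)
  nlinarith [mul_pos h2 (sub_pos.mpr hst)]

/-- A decay rate function grows at least linearly. -/
theorem exists_linear_growth (h : IsDecayRate ψ tstar) :
    ∃ (c C : ℝ) (N : ℕ), 0 < c ∧ 0 ≤ C ∧ tstar < N ∧
      (∀ s t : ℝ, (N : ℝ) ≤ s → s ≤ t → c * (t - s) ≤ ψ t - ψ s) ∧
      ∀ n d : ℕ, N ≤ d → n ≤ d → c * ((d : ℝ) - n) - C ≤ ψ d - ψ n := by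
  obtain ⟨N, hN⟩ := exists_nat_gt tstar
  have hN0 : (0 : ℝ) < N := h.nonneg.trans_lt hN
  set c := ψ N / N with hc
  have hc0 : 0 < c := div_pos (h.pos_of_lt hN) hN0
  -- `ψ` need not be monotone on `(0, tstar]`; the finitely many indices below `N`, including 0, are
  -- absorbed in a constant.
  set M := ∑ n ∈ Finset.range N, |ψ n - ψ N| with hM
  have hM0 : 0 ≤ M := Finset.sum_nonneg fun _ _ => abs_nonneg _
  refine ⟨c, c * N + M, N, hc0, by positivity, hN, fun s t hs hst => h.slope_mul_le_sub hN hs hst,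
    fun n d hNd hnd => ?_⟩
  have hNd' : (N : ℝ) ≤ d := by exact_mod_cast hNd
  have hnd' : (n : ℝ) ≤ d := by exact_mod_cast hnd
  rcases le_or_gt N n with hn | hn
  · have := h.slope_mul_le_sub hN (s := n) (t := d) (by exact_mod_cast hn) hnd'
    have h2 : 0 ≤ c * N := by positivity
    linarith
  · have h1 := h.slope_mul_le_sub hN le_rfl hNd'
    have h2 : ψ n - ψ N ≤ M := (le_abs_self _).trans <|
      Finset.single_le_sum (f := fun n : ℕ => |ψ n - ψ N|) (fun _ _ => abs_nonneg _)
        (Finset.mem_range.mpr hn)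
    have h3 : 0 ≤ c * n := by positivity
    nlinarith

theorem decayInv_spec (h : IsDecayRate ψ tstar) {L : ℝ} (hL : 0 < L) :
    tstar < decayInv ψ tstar L ∧ ψ (decayInv ψ tstar L) = L := by
  have hL' : L ∈ ψ '' Set.Ioi tstar := by rw [h.image_eq]; exact hL
  exact ⟨Function.invFunOn_mem hL', Function.invFunOn_eq hL'⟩

theorem tendsto_decayInv (h : IsDecayRate ψ tstar) :
    Filter.Tendsto (decayInv ψ tstar) Filter.atTop Filter.atTop := by
  refine Filter.tendsto_atTop.mpr fun T => ?_
  set T' := max T (tstar + 1)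
  have hT' : tstar < T' := lt_of_lt_of_le (by linarith) (le_max_right _ _)
  filter_upwards [Filter.eventually_gt_atTop (ψ T')] with L hL
  obtain ⟨h1, h2⟩ := h.decayInv_spec ((h.pos_of_lt hT').trans hL)
  refine (le_max_left T (tstar + 1)).trans (le_of_lt ?_)
  by_contra! hle
  have := h.strictMonoOn.monotoneOn h1 hT' hle
  linarith

end IsDecayRate

/-! ### Initial index sets and geometric decay of the semi-axes. -/

/-- The positive integers up to `D`. -/
def pnatUpTo (D : ℕ) : Finset ℕ+ :=
  (Finset.range D).map ⟨Nat.succPNat, Nat.succPNat_injective⟩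

theorem mem_pnatUpTo {D : ℕ} {n : ℕ+} : n ∈ pnatUpTo D ↔ (n : ℕ) ≤ D := by
  simp only [pnatUpTo, Finset.mem_map, Finset.mem_range, Function.Embedding.coeFn_mk]
  constructor
  · rintro ⟨j, hj, rfl⟩
    exact hj
  · intro h
    exact ⟨n.natPred, lt_of_lt_of_le (by rw [← PNat.natPred_add_one n]; omega) h,
      PNat.succPNat_natPred n⟩

theorem sum_pnatUpTo (D : ℕ) (f : ℕ → ℝ) :
    ∑ n ∈ pnatUpTo D, f n = ∑ n ∈ Finset.Icc 1 D, f n := by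
  rw [pnatUpTo, Finset.sum_map]
  simp only [Function.Embedding.coeFn_mk, Nat.succPNat_coe, Nat.succ_eq_add_one]
  rw [Finset.range_eq_Ico, Finset.sum_Ico_add' f 0 D 1]
  rfl

theorem card_pnatUpTo (D : ℕ) : (pnatUpTo D).card = D := by
  rw [pnatUpTo, Finset.card_map, Finset.card_range]

theorem pnatUpTo_nonempty {D : ℕ} (hD : 1 ≤ D) : (pnatUpTo D).Nonempty :=
  ⟨1, mem_pnatUpTo.mpr hD⟩

theorem expSemiAxes_pos {c₀ : ℝ} (hc₀ : 0 < c₀) (ψ : ℝ → ℝ) (n : ℕ+) :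
    0 < expSemiAxes c₀ ψ n := by
  unfold expSemiAxes; positivity

theorem expSemiAxes_div {c₀ ε : ℝ} (hc₀ : 0 < c₀) (hε : 0 < ε) (ψ : ℝ → ℝ) (n : ℕ+) :
    expSemiAxes c₀ ψ n / ε =
      (2 : ℝ) ^ (Real.logb 2 ε⁻¹ + Real.logb 2 c₀ - ψ ((n : ℕ) : ℝ)) := by
  rw [Real.rpow_sub two_pos, Real.rpow_add two_pos, Real.rpow_logb two_pos (by norm_num)
    (by positivity), Real.rpow_logb two_pos (by norm_num) hc₀, Real.rpow_def_of_pos two_pos,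
    expSemiAxes, Real.exp_neg]
  field_simp

/-- Finite sums of powers of `r < 1` over positive integers exceeding `D`. -/
theorem sum_pow_sub_le {r : ℝ} (hr0 : 0 ≤ r) (hr1 : r < 1) (D : ℕ) (t : Finset ℕ+)
    (ht : ∀ n ∈ t, D < (n : ℕ)) : ∑ n ∈ t, r ^ ((n : ℕ) - D) ≤ (1 - r)⁻¹ := by
  classical
  have hinj : Set.InjOn (fun n : ℕ+ => (n : ℕ) - D) t := fun a ha b hb hab => by
    have h1 := ht a ha
    have h2 := ht b hb
    apply PNat.coe_injective
    simp only at hab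
    omega
  rw [← Finset.sum_image (f := fun j => r ^ j) hinj, ← tsum_geometric_of_lt_one hr0 hr1]
  exact (summable_geometric_of_lt_one hr0 hr1).sum_le_tsum _ fun j _ => pow_nonneg hr0 j

theorem sum_Icc_pow_sub_le {r : ℝ} (hr0 : 0 ≤ r) (hr1 : r < 1) (d : ℕ) :
    ∑ n ∈ Finset.Icc 1 d, r ^ (d - n) ≤ (1 - r)⁻¹ := by
  classical
  have hinj : Set.InjOn (fun n : ℕ => d - n) (Finset.Icc 1 d : Finset ℕ) := fun a ha b hb hab => by
    simp only [Finset.coe_Icc, Set.mem_Icc] at ha hb hab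
    omega
  rw [← Finset.sum_image (f := fun j => r ^ j) hinj, ← tsum_geometric_of_lt_one hr0 hr1]
  exact (summable_geometric_of_lt_one hr0 hr1).sum_le_tsum _ fun j _ => pow_nonneg hr0 j

/-- The tails of the semi-axes decay geometrically. -/
theorem sum_expSemiAxes_tail_le {ψ : ℝ → ℝ} {c c₀ : ℝ} (hc : 0 < c) (hc₀ : 0 < c₀) {N d m : ℕ}
    (hgrow : ∀ s t : ℝ, (N : ℝ) ≤ s → s ≤ t → c * (t - s) ≤ ψ t - ψ s) (hd : N ≤ d)
    (t : Finset ℕ+) (ht : Disjoint t (pnatUpTo (d + m))) :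
    ∑ n ∈ t, expSemiAxes c₀ ψ n ≤
      c₀ * (2 : ℝ) ^ (-ψ d) * ((2 : ℝ) ^ (-c)) ^ m * (1 - (2 : ℝ) ^ (-c))⁻¹ := by
  set r := (2 : ℝ) ^ (-c) with hr
  have hr0 : 0 < r := by positivity
  have hr1 : r < 1 := Real.rpow_lt_one_of_one_lt_of_neg one_lt_two (by linarith)
  have hlt : ∀ n ∈ t, d + m < (n : ℕ) := fun n hn => by
    have := Finset.disjoint_left.mp ht hn
    rw [mem_pnatUpTo] at this
    omega
  refine le_trans ?_ (mul_le_mul_of_nonneg_left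
    (sum_pow_sub_le hr0.le hr1 (d + m) t hlt) (by positivity))
  rw [Finset.mul_sum]
  refine Finset.sum_le_sum fun n hn => ?_
  have h1 := hlt n hn
  have h2 : (N : ℝ) ≤ d := by exact_mod_cast hd
  have h3 : (d : ℝ) ≤ (n : ℕ) := by exact_mod_cast (by omega : d ≤ (n : ℕ))
  have h4 := hgrow d (n : ℕ) h2 h3
  have h5 : expSemiAxes c₀ ψ n = c₀ * (2 : ℝ) ^ (-ψ ((n : ℕ) : ℝ)) := by
    rw [expSemiAxes, Real.rpow_def_of_pos two_pos, mul_neg]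
  rw [h5, mul_assoc, mul_assoc, ← pow_add]
  refine mul_le_mul_of_nonneg_left ?_ hc₀.le
  have h6 : m + ((n : ℕ) - (d + m)) = (n : ℕ) - d := by omega
  rw [h6, hr, ← Real.rpow_natCast, ← Real.rpow_mul two_pos.le, ← Real.rpow_add two_pos,
    Nat.cast_sub (by omega)]
  refine Real.rpow_le_rpow_of_exponent_le one_le_two ?_
  linarith

/-- The semi-axes outside a large enough finite set have arbitrarily small sum. -/
theorem exists_forall_sum_expSemiAxes_le {ψ : ℝ → ℝ} {tstar : ℝ} (hψ : IsDecayRate ψ tstar)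
    {c₀ : ℝ} (hc₀ : 0 < c₀) {ε : ℝ} (hε : 0 < ε) :
    ∃ s : Finset ℕ+, s.Nonempty ∧
      ∀ t : Finset ℕ+, Disjoint t s → ∑ n ∈ t, expSemiAxes c₀ ψ n ≤ ε := by
  obtain ⟨c, C, N, hc, hC, hN, hgrow, -⟩ := hψ.exists_linear_growth
  have hr0 : 0 < (2 : ℝ) ^ (-c) := by positivity
  have hr1 : (2 : ℝ) ^ (-c) < 1 := Real.rpow_lt_one_of_one_lt_of_neg one_lt_two (by linarith)
  have hN1 : 1 ≤ N := by
    have : (0 : ℝ) < N := hψ.nonneg.trans_lt hN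
    exact_mod_cast this
  have hlim : Filter.Tendsto (fun m : ℕ => c₀ * (2 : ℝ) ^ (-ψ N) * ((2 : ℝ) ^ (-c)) ^ m *
      (1 - (2 : ℝ) ^ (-c))⁻¹) Filter.atTop (𝓝 0) := by
    simpa using ((tendsto_pow_atTop_nhds_zero_of_lt_one hr0.le hr1).const_mul
      (c₀ * (2 : ℝ) ^ (-ψ N))).mul_const (1 - (2 : ℝ) ^ (-c))⁻¹
  obtain ⟨m, hm⟩ := (hlim.eventually_le_const hε).exists
  exact ⟨pnatUpTo (N + m), pnatUpTo_nonempty (by omega), fun t ht =>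
    (sum_expSemiAxes_tail_le hc hc₀ hgrow le_rfl t ht).trans hm⟩

theorem summable_expSemiAxes {ψ : ℝ → ℝ} {tstar : ℝ} (hψ : IsDecayRate ψ tstar)
    {c₀ : ℝ} (hc₀ : 0 < c₀) : Summable (expSemiAxes c₀ ψ) := by
  refine summable_iff_vanishing_norm.mpr fun ε hε => ?_
  obtain ⟨s, -, hs⟩ := exists_forall_sum_expSemiAxes_le hψ hc₀ (half_pos hε)
  refine ⟨s, fun t ht => ?_⟩
  rw [Real.norm_of_nonneg (Finset.sum_nonneg fun n _ => (expSemiAxes_pos hc₀ ψ n).le)]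
  linarith [hs t ht]

/-! ### Elementary estimates for logarithms. -/

theorem logb_two_one_add_le {x : ℝ} (hx : 0 ≤ x) : Real.logb 2 (1 + x) ≤ 2 * x := by
  have h1 : Real.log (1 + x) ≤ x := by
    have := Real.log_le_sub_one_of_pos (by linarith : 0 < 1 + x)
    linarith
  have h2 : (1 / 2 : ℝ) ≤ Real.log 2 := by linarith [Real.log_two_gt_d9]
  rw [Real.logb, div_le_iff₀ (by linarith)]
  nlinarith

/-- The linear bound suffices: it is applied either to a geometric sequence in `n` with sum `O(d)`,
or to boundedly many terms. -/
theorem logb_two_four_add_le {x : ℝ} (hx : 0 ≤ x) : Real.logb 2 (4 + x) ≤ 2 + x := by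
  have h1 : 4 + x = 2 ^ (2 : ℕ) * (1 + x / 4) := by ring
  rw [h1, Real.logb_mul (by norm_num) (by positivity), Real.logb_pow, Real.logb_self_eq_one
    one_lt_two]
  have := logb_two_one_add_le (by positivity : 0 ≤ x / 4)
  push_cast
  linarith

/-- Passing from dimension `d` to `d + m` changes `κ d log d` by a linear amount only. -/
theorem mul_mul_logb_add_le {κ : ℝ} (hκ : κ ≤ 1) {d : ℕ} (hd : 1 ≤ d) (m : ℕ) :
    κ * (((d + m : ℕ) : ℝ) * Real.logb 2 (d + m : ℕ)) ≤
      κ * (d * Real.logb 2 d) + (2 * (1 + m) * m + 2 * m) * d := by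
  have hd0 : (1 : ℝ) ≤ d := by exact_mod_cast hd
  have hm0 : (0 : ℝ) ≤ m := m.cast_nonneg
  have hld : 0 ≤ Real.logb 2 (d : ℝ) := Real.logb_nonneg one_lt_two hd0
  have hdiff : Real.logb 2 (d + m : ℕ) = Real.logb 2 d + Real.logb 2 (1 + m / d) := by
    rw [← Real.logb_mul (by positivity) (by positivity)]
    congr 1
    push_cast
    field_simp
  have hb : 0 ≤ Real.logb 2 (1 + (m : ℝ) / d) := Real.logb_nonneg one_lt_two (by
    have : 0 ≤ (m : ℝ) / d := by positivity
    linarith)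
  have hb' : d * Real.logb 2 (1 + (m : ℝ) / d) ≤ 2 * m := by
    have := mul_le_mul_of_nonneg_left (logb_two_one_add_le (by positivity : 0 ≤ (m : ℝ) / d))
      (by linarith : (0 : ℝ) ≤ d)
    refine this.trans (le_of_eq ?_)
    field_simp
  have hD : Real.logb 2 (d + m : ℕ) ≤ 2 * ((1 + m) * d) := by
    have h1 := logb_two_one_add_le (x := (d : ℝ) + m - 1) (by linarith)
    have h2 : (1 : ℝ) + (d + m - 1) = (d + m : ℕ) := by push_cast; ring
    rw [h2] at h1
    nlinarith
  have hsplit : ((d + m : ℕ) : ℝ) * Real.logb 2 (d + m : ℕ) = d * Real.logb 2 d +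
      (d * Real.logb 2 (1 + (m : ℝ) / d) + m * Real.logb 2 (d + m : ℕ)) := by
    push_cast at hdiff ⊢
    rw [hdiff]
    ring
  set E := d * Real.logb 2 (1 + (m : ℝ) / d) + m * Real.logb 2 (d + m : ℕ) with hE
  have hE0 : 0 ≤ E := by
    have : 0 ≤ Real.logb 2 ((d + m : ℕ) : ℝ) := by rw [hdiff]; linarith
    positivity
  have hE1 : E ≤ (2 * (1 + m) * m + 2 * m) * d := by
    have := mul_le_mul_of_nonneg_left hD hm0
    nlinarith
  -- As `E ≥ 0` and `κ ≤ 1`, also for negative `κ` one has `κ * E ≤ E`.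
  rw [hsplit, mul_add]
  nlinarith

theorem psiAverage_mul (ψ : ℝ → ℝ) {d : ℕ} (hd : 1 ≤ d) :
    d * psiAverage ψ d = ∑ n ∈ Finset.Icc 1 d, (ψ d - ψ n) := by
  have : (d : ℝ) ≠ 0 := by positivity
  rw [psiAverage]
  field_simp

/-! ### Entropy bounds for exponentially decaying semi-axes. -/

section asymptotics

variable {ψ : ℝ → ℝ} {tstar : ℝ} {c₀ : ℝ}

/-- Lower bound for the entropy of an ellipsoid whose semi-axis of index `d` is comparable
to `ε`. -/
theorem exists_le_metricEntropy_expSemiAxes (𝕜 : Type*) [RCLike 𝕜] (p q : ℝ≥0∞)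
    [Fact (1 ≤ p)] [Fact (1 ≤ q)] (hψ : IsDecayRate ψ tstar) (hc₀ : 0 < c₀) :
    ∃ C : ℝ, ∀ d : ℕ, 1 ≤ d → ∀ ε : ℝ, 0 < ε →
      (d : ℝ) * Module.finrank ℝ 𝕜 * (psiAverage ψ d - (ψ d - (Real.logb 2 ε⁻¹ + Real.logb 2 c₀))
        + ((q⁻¹).toReal - (p⁻¹).toReal) * Real.logb 2 d) - C * d ≤
        metricEntropy ε (ellipsoidIn 𝕜 p q (expSemiAxes c₀ ψ)) := by
  obtain ⟨C, hC⟩ := exists_le_metricEntropy 𝕜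
  obtain ⟨C', hC'⟩ := exists_metricEntropy_le 𝕜
  refine ⟨C, fun d hd ε hε => ?_⟩
  have hpos := expSemiAxes_pos hc₀ ψ
  obtain ⟨s, hs, htail⟩ := exists_forall_sum_expSemiAxes_le hψ hc₀ (by positivity : 0 < ε / 4)
  -- The set `s` only serves to make the covering number finite; the bound comes from the first `d`
  -- coordinates.
  have h1 := hC p q _ hpos (pnatUpTo d) (pnatUpTo_nonempty hd) ε hε
    (hC' p q _ hpos s hs ε hε htail).1
  simp only [expSemiAxes_div hc₀ hε, Real.logb_rpow two_pos (by norm_num : (2 : ℝ) ≠ 1),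
    card_pnatUpTo] at h1
  set L := Real.logb 2 ε⁻¹ + Real.logb 2 c₀
  rw [sum_pnatUpTo d fun n => L - ψ n +
    ((q⁻¹).toReal - (p⁻¹).toReal) * Real.logb 2 d] at h1
  refine le_trans (le_of_eq ?_) h1
  have h2 : ∑ n ∈ Finset.Icc 1 d, (L - ψ n +
      ((q⁻¹).toReal - (p⁻¹).toReal) * Real.logb 2 d) =
      ∑ n ∈ Finset.Icc 1 d, (ψ d - ψ n) +
        d * (L - ψ d + ((q⁻¹).toReal - (p⁻¹).toReal) * Real.logb 2 d) := by
    have h3 : (d : ℝ) * (L - ψ d + ((q⁻¹).toReal - (p⁻¹).toReal) * Real.logb 2 d) =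
        ∑ _n ∈ Finset.Icc 1 d,
          (L - ψ d + ((q⁻¹).toReal - (p⁻¹).toReal) * Real.logb 2 d) := by
      rw [Finset.sum_const, nsmul_eq_mul, Nat.card_Icc, Nat.add_sub_cancel]
    rw [h3, ← Finset.sum_add_distrib]
    exact Finset.sum_congr rfl fun n _ => by ring
  rw [h2, ← psiAverage_mul ψ hd]
  ring

/-- Upper bound for the entropy of an ellipsoid whose semi-axis of index `d` is at most `ε`. -/
theorem exists_metricEntropy_expSemiAxes_le (𝕜 : Type*) [RCLike 𝕜] (p q : ℝ≥0∞)
    [Fact (1 ≤ p)] [Fact (1 ≤ q)] (hψ : IsDecayRate ψ tstar) (hc₀ : 0 < c₀) :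
    ∃ (C : ℝ) (N : ℕ), ∀ d : ℕ, N ≤ d → ∀ ε : ℝ, 0 < ε →
      Real.logb 2 ε⁻¹ + Real.logb 2 c₀ ≤ ψ d →
        metricEntropy ε (ellipsoidIn 𝕜 p q (expSemiAxes c₀ ψ)) ≤
      (d : ℝ) * Module.finrank ℝ 𝕜 * (psiAverage ψ d +
        ((q⁻¹).toReal - (p⁻¹).toReal) * Real.logb 2 d) + C * d := by
  obtain ⟨C, hC⟩ := exists_metricEntropy_le 𝕜
  obtain ⟨c, C₀, N, hc, hC₀, hN, hgrow, hgrow'⟩ := hψ.exists_linear_growth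
  set r := (2 : ℝ) ^ (-c) with hr
  have hr0 : 0 < r := by positivity
  have hr1 : r < 1 := Real.rpow_lt_one_of_one_lt_of_neg one_lt_two (by linarith)
  have hN1 : 1 ≤ N := by
    have : (0 : ℝ) < N := hψ.nonneg.trans_lt hN
    exact_mod_cast this
  -- The tail beyond `d + m` is at most `c₀ 2^(-ψ(d)) r^m / (1 - r)` with `c₀ 2^(-ψ(d)) ≤ ε`, so `m`
  -- depends neither on `ε` nor on `d`.
  obtain ⟨m, hm⟩ : ∃ m : ℕ, r ^ m * (1 - r)⁻¹ ≤ 1 / 4 := by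
    have hlim : Filter.Tendsto (fun m : ℕ => r ^ m * (1 - r)⁻¹) Filter.atTop (𝓝 0) := by
      simpa using (tendsto_pow_atTop_nhds_zero_of_lt_one hr0.le hr1).mul_const (1 - r)⁻¹
    exact (hlim.eventually_le_const (by norm_num)).exists
  set κ := (q⁻¹).toReal - (p⁻¹).toReal with hκ
  have hκ1 : κ ≤ 1 := by
    linarith [inv_toReal_le_one q, ENNReal.toReal_nonneg (a := p⁻¹)]
  have hκ2 : -κ ≤ 1 := by
    linarith [inv_toReal_le_one p, ENNReal.toReal_nonneg (a := q⁻¹)]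
  set k : ℝ := ((Module.finrank ℝ 𝕜 : ℕ) : ℝ)
  have hk : 0 < k := Nat.cast_pos.mpr (finrank_real_rclike_pos 𝕜)
  set S := (2 : ℝ) ^ C₀ * (1 - r)⁻¹ with hS
  have hS0 : 0 < S := by
    have : 0 < 1 - r := by linarith
    positivity
  refine ⟨k * (2 + (1 + m) * S + m * (2 + (1 + m)) + (2 * (1 + m) * m + 2 * m)) + |C| * (1 + m), N,
    fun d hNd ε hε hL => ?_⟩
  have hd : 1 ≤ d := hN1.trans hNd
  have hd1 : (1 : ℝ) ≤ d := by exact_mod_cast hd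
  have hm0 : (0 : ℝ) ≤ m := m.cast_nonneg
  set L := Real.logb 2 ε⁻¹ + Real.logb 2 c₀ with hLdef
  set D := d + m with hD
  have hD1 : (1 : ℝ) ≤ D := by exact_mod_cast (by omega : 1 ≤ D)
  have hDd : (D : ℝ) ≤ (1 + m) * d := by rw [hD]; push_cast; nlinarith
  have hεL : c₀ * (2 : ℝ) ^ (-ψ d) ≤ ε := by
    have h1 : c₀ = ε * (2 : ℝ) ^ L := by
      rw [hLdef, Real.rpow_add two_pos, Real.rpow_logb two_pos (by norm_num) (by positivity),
        Real.rpow_logb two_pos (by norm_num) hc₀]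
      field_simp
    rw [h1, mul_assoc, ← Real.rpow_add two_pos]
    exact mul_le_of_le_one_right hε.le
      (Real.rpow_le_one_of_one_le_of_nonpos one_le_two (by linarith))
  have htail : ∀ t : Finset ℕ+, Disjoint t (pnatUpTo D) →
      ∑ n ∈ t, expSemiAxes c₀ ψ n ≤ ε / 4 := fun t ht => by
    refine (sum_expSemiAxes_tail_le hc hc₀ hgrow hNd t ht).trans ?_
    rw [← hr, mul_assoc]
    have h1 : 0 ≤ c₀ * (2 : ℝ) ^ (-ψ d) := by positivity
    have h2 := mul_le_mul_of_nonneg_left hm h1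
    linarith
  have h1 := (hC p q _ (expSemiAxes_pos hc₀ ψ) (pnatUpTo D) (pnatUpTo_nonempty (by omega)) ε hε
    htail).2
  simp only [expSemiAxes_div hc₀ hε, card_pnatUpTo] at h1
  rw [← hLdef, sum_pnatUpTo D fun n => Real.logb 2 (4 * (2 : ℝ) ^ (L - ψ n) +
    (D : ℝ) ^ ((p⁻¹).toReal - (q⁻¹).toReal)) + κ * Real.logb 2 D, Finset.sum_add_distrib,
    Finset.sum_const, nsmul_eq_mul, Nat.card_Icc, Nat.add_sub_cancel] at h1
  have hDpow : (D : ℝ) ^ ((p⁻¹).toReal - (q⁻¹).toReal) ≤ D := by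
    nth_rewrite 2 [← Real.rpow_one (D : ℝ)]
    exact Real.rpow_le_rpow_of_exponent_le hD1 (by linarith)
  have hDpow0 : 0 < (D : ℝ) ^ ((p⁻¹).toReal - (q⁻¹).toReal) := by positivity
  set f : ℕ → ℝ := fun n => Real.logb 2 (4 * (2 : ℝ) ^ (L - ψ n) +
    (D : ℝ) ^ ((p⁻¹).toReal - (q⁻¹).toReal)) with hf
  -- Factoring out `2^(ψ(d) - ψ(n))`, which grows geometrically in `d - n`, leaves of the second
  -- summand (at most `D`) a geometric sequence with sum `O(D)`.
  have hlow : ∀ n ∈ Finset.Icc 1 d, f n ≤ (ψ d - ψ n) + (2 + D * 2 ^ C₀ * r ^ (d - n)) := by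
    intro n hn
    obtain ⟨hn1, hnd⟩ := Finset.mem_Icc.mp hn
    have h2 : 4 * (2 : ℝ) ^ (L - ψ n) + (D : ℝ) ^ ((p⁻¹).toReal - (q⁻¹).toReal) ≤
        2 ^ (ψ d - ψ n) * (4 + D * 2 ^ C₀ * r ^ (d - n)) := by
      have h3 : (2 : ℝ) ^ (L - ψ n) ≤ 2 ^ (ψ d - ψ n) :=
        Real.rpow_le_rpow_of_exponent_le one_le_two (by linarith)
      have h4 : 1 ≤ (2 : ℝ) ^ (ψ d - ψ n) * (2 ^ C₀ * r ^ (d - n)) := by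
        rw [hr, ← Real.rpow_natCast, ← Real.rpow_mul two_pos.le, ← Real.rpow_add two_pos,
          ← Real.rpow_add two_pos, Nat.cast_sub hnd]
        exact Real.one_le_rpow one_le_two (by linarith [hgrow' n d hNd hnd])
      have h5 : (D : ℝ) ≤ D * ((2 : ℝ) ^ (ψ d - ψ n) * (2 ^ C₀ * r ^ (d - n))) :=
        le_mul_of_one_le_right (by linarith) h4
      linarith
    have h6 := Real.logb_le_logb_of_le one_lt_two (by positivity) h2
    rw [Real.logb_mul (by positivity) (by positivity),
      Real.logb_rpow two_pos (by norm_num)] at h6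
    exact h6.trans (add_le_add le_rfl (logb_two_four_add_le (by positivity)))
  -- Only `m` indices are concerned, so a bound linear in `D` is enough.
  have hhigh : ∀ n ∈ Finset.Ioc d D, f n ≤ 2 + D := by
    intro n hn
    obtain ⟨hn1, -⟩ := Finset.mem_Ioc.mp hn
    have h2 : (N : ℝ) ≤ d := by exact_mod_cast hNd
    have h3 : (d : ℝ) ≤ n := by exact_mod_cast hn1.le
    have h4 := hgrow d n h2 h3
    have h5 : 0 ≤ c * ((n : ℝ) - d) := mul_nonneg hc.le (by linarith)
    have h6 : (2 : ℝ) ^ (L - ψ n) ≤ 1 :=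
      Real.rpow_le_one_of_one_le_of_nonpos one_le_two (by linarith)
    have h7 := Real.logb_le_logb_of_le one_lt_two (by positivity)
      (by linarith : 4 * (2 : ℝ) ^ (L - ψ n) + (D : ℝ) ^ ((p⁻¹).toReal - (q⁻¹).toReal) ≤ 4 + D)
    exact h7.trans (logb_two_four_add_le (by linarith))
  have hsplit : ∑ n ∈ Finset.Icc 1 D, f n =
      ∑ n ∈ Finset.Icc 1 d, f n + ∑ n ∈ Finset.Ioc d D, f n := by
    have h2 : ∀ a : ℕ, Finset.Icc 1 a = Finset.Ioc 0 a := fun a => by ext; simp; omega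
    rw [h2, h2, Finset.sum_Ioc_consecutive f (Nat.zero_le d) (by omega)]
  have hA : ∑ n ∈ Finset.Icc 1 d, f n ≤ d * psiAverage ψ d + 2 * d + D * S := by
    refine (Finset.sum_le_sum hlow).trans ?_
    rw [Finset.sum_add_distrib, Finset.sum_add_distrib, ← Finset.mul_sum, Finset.sum_const,
      nsmul_eq_mul, Nat.card_Icc, Nat.add_sub_cancel, psiAverage_mul ψ hd, hS, ← mul_assoc]
    have := mul_le_mul_of_nonneg_left (sum_Icc_pow_sub_le hr0.le hr1 d)
      (by positivity : 0 ≤ (D : ℝ) * 2 ^ C₀)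
    linarith
  have hB : ∑ n ∈ Finset.Ioc d D, f n ≤ m * (2 + D) := by
    refine (Finset.sum_le_sum hhigh).trans (le_of_eq ?_)
    rw [Finset.sum_const, nsmul_eq_mul, Nat.card_Ioc, hD, Nat.add_sub_cancel_left]
  have hK := mul_mul_logb_add_le hκ1 hd m
  rw [← hD] at hK
  have hCD : C * D ≤ |C| * (1 + m) * d := by
    have h2 : C * D ≤ |C| * D := mul_le_mul_of_nonneg_right (le_abs_self C) (by linarith)
    have h3 := mul_le_mul_of_nonneg_left hDd (abs_nonneg C)
    linarith
  have hDS := mul_le_mul_of_nonneg_right hDd hS0.le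
  have hmD : m * (2 + (D : ℝ)) ≤ m * (2 + (1 + m)) * d := by
    have h2 : 2 + (D : ℝ) ≤ (2 + (1 + m)) * d := by nlinarith
    have := mul_le_mul_of_nonneg_left h2 hm0
    linarith
  have hfinal : ∑ n ∈ Finset.Icc 1 D, f n + D * (κ * Real.logb 2 D) ≤
      d * (psiAverage ψ d + κ * Real.logb 2 d) +
      (2 + (1 + m) * S + m * (2 + (1 + m)) + (2 * (1 + m) * m + 2 * m)) * d := by
    rw [hsplit]
    linarith
  have := mul_le_mul_of_nonneg_left hfinal hk.le
  linarith

/-- The entropy formula, with an error controlled by the `ψ`-difference. -/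
theorem exists_abs_metricEntropy_div_sub_le (𝕜 : Type*) [RCLike 𝕜] (p q : ℝ≥0∞)
    [Fact (1 ≤ p)] [Fact (1 ≤ q)] (hψ : IsDecayRate ψ tstar) (hc₀ : 0 < c₀) :
    ∃ (C : ℝ) (N : ℕ), ∀ d : ℕ, N ≤ d → ∀ ε : ℝ, 0 < ε →
      ψ ((d : ℝ) - 1) ≤ Real.logb 2 ε⁻¹ + Real.logb 2 c₀ →
      Real.logb 2 ε⁻¹ + Real.logb 2 c₀ ≤ ψ d →
      |metricEntropy ε (ellipsoidIn 𝕜 p q (expSemiAxes c₀ ψ)) / sigmaDim 𝕜 d - psiAverage ψ d -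
        ((q⁻¹).toReal - (p⁻¹).toReal) * Real.logb 2 (sigmaDim 𝕜 d)| ≤
        C * |psiDifference ψ d| := by
  obtain ⟨C₁, h₁⟩ := exists_le_metricEntropy_expSemiAxes 𝕜 p q hψ hc₀
  obtain ⟨C₂, N₂, h₂⟩ := exists_metricEntropy_expSemiAxes_le 𝕜 p q hψ hc₀
  obtain ⟨c, C₀, N, hc, hC₀, hN, hgrow, -⟩ := hψ.exists_linear_growth
  set κ := (q⁻¹).toReal - (p⁻¹).toReal with hκ
  set k : ℝ := ((Module.finrank ℝ 𝕜 : ℕ) : ℝ) with hkdef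
  have hk : 0 < k := Nat.cast_pos.mpr (finrank_real_rclike_pos 𝕜)
  -- The first term pays for replacing `log d` by `log σ(d)`, the others for the linear errors
  -- divided by `σ(d) = k d`.
  set B := |κ * Real.logb 2 k| + (|C₁| + |C₂|) / k with hB
  -- The 1 accounts for `ψ(d) - L ≤ ζ(d)`, and `B / c` for `B ≤ (B / c) ζ(d)`. The bound `d ≥ N + 1`
  -- puts `d - 1` in the range where the slope is at least `c`.
  refine ⟨1 + B / c, max N₂ (N + 1), fun d hd ε hε hL₁ hL₂ => ?_⟩
  have hdN₂ : N₂ ≤ d := (le_max_left _ _).trans hd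
  have hdN : N + 1 ≤ d := (le_max_right _ _).trans hd
  have hdN' : (N : ℝ) ≤ d - 1 := by
    have : ((N + 1 : ℕ) : ℝ) ≤ d := by exact_mod_cast hdN
    push_cast at this
    linarith
  have hd0 : (0 : ℝ) < d := by linarith [N.cast_nonneg (α := ℝ)]
  have hζ : c ≤ psiDifference ψ d := by
    have := hgrow ((d : ℝ) - 1) d hdN' (by linarith)
    rw [psiDifference]
    linarith
  have hζ' : ψ d - (Real.logb 2 ε⁻¹ + Real.logb 2 c₀) ≤ psiDifference ψ d := by
    rw [psiDifference]; linarith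
  have hσ : (sigmaDim 𝕜 d : ℝ) = k * d := by rw [sigmaDim, Nat.cast_mul]
  have hlog : Real.logb 2 (k * d) = Real.logb 2 k + Real.logb 2 d :=
    Real.logb_mul hk.ne' hd0.ne'
  have hlow := h₁ d (by omega) ε hε
  have hup := h₂ d hdN₂ ε hε hL₂
  set H := metricEntropy ε (ellipsoidIn 𝕜 p q (expSemiAxes c₀ ψ))
  have hkd : 0 < k * d := by positivity
  have hup' : H / (k * d) ≤ psiAverage ψ d + κ * Real.logb 2 d + C₂ / k := by
    rw [div_le_iff₀ hkd]
    have : C₂ / k * (k * d) = C₂ * d := by field_simp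
    nlinarith
  have hlow' : psiAverage ψ d - psiDifference ψ d + κ * Real.logb 2 d - C₁ / k ≤ H / (k * d) := by
    rw [le_div_iff₀ hkd]
    have h3 : C₁ / k * (k * d) = C₁ * d := by field_simp
    have h4 := mul_le_mul_of_nonneg_left hζ' hkd.le
    nlinarith
  have hζ0 : 0 < psiDifference ψ d := hc.trans_le hζ
  have hBζ : B ≤ B / c * psiDifference ψ d := by
    have hB0 : 0 ≤ B := by positivity
    rw [div_mul_eq_mul_div, le_div_iff₀ hc]
    exact mul_le_mul_of_nonneg_left hζ hB0
  have hC₁ : C₁ / k ≤ |C₁| / k := by gcongr; exact le_abs_self _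
  have hC₂ : C₂ / k ≤ |C₂| / k := by gcongr; exact le_abs_self _
  have hC₁' : 0 ≤ |C₁| / k := by positivity
  have hC₂' : 0 ≤ |C₂| / k := by positivity
  have hBsum : B = |κ * Real.logb 2 k| + |C₁| / k + |C₂| / k := by rw [hB]; ring
  rw [hσ, hlog, abs_of_pos hζ0, abs_le]
  constructor
  · linarith [le_abs_self (κ * Real.logb 2 k)]
  · linarith [neg_abs_le (κ * Real.logb 2 k)]

end asymptotics

/-! ### The entropy formula. -/

theorem mainTheorem1 {𝕜 : Type*} [RCLike 𝕜] (p q : ℝ≥0∞) [Fact (1 ≤ p)] [Fact (1 ≤ q)]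
    (ψ : ℝ → ℝ) (tstar : ℝ) (hψ : IsDecayRate ψ tstar) (c₀ : ℝ) (hc₀ : 0 < c₀) :
    -- the ellipsoid is contained in `ℓ^q` and its covering numbers there are finite
    (∀ x ∈ ellipsoid 𝕜 p (expSemiAxes c₀ ψ), Memℓp (fun n => x n) q) ∧
    (∀ ε : ℝ, 0 < ε → Metric.externalCoveringNumber ε.toNNReal
        (ellipsoidIn 𝕜 p q (expSemiAxes c₀ ψ)) ≠ ⊤) ∧
    ∃ d : ℝ → ℕ,
      (∀ ε : ℝ, 0 < ε → 1 ≤ d ε) ∧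
      (fun ε : ℝ => (d ε : ℝ) - decayInv ψ tstar (Real.logb 2 ε⁻¹ + Real.logb 2 c₀))
        =O[𝓝[>] (0 : ℝ)] (fun _ => (1 : ℝ)) ∧
      ∃ R : ℝ → ℝ,
        R =O[𝓝[>] (0 : ℝ)] (fun ε => psiDifference ψ (d ε)) ∧
        ∀ ε : ℝ, 0 < ε →
          metricEntropy ε (ellipsoidIn 𝕜 p q (expSemiAxes c₀ ψ)) =
            (sigmaDim 𝕜 (d ε) : ℝ) *
              (psiAverage ψ (d ε)
                + ((q⁻¹).toReal - (p⁻¹).toReal) * Real.logb 2 (sigmaDim 𝕜 (d ε) : ℝ)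
                + R ε) := by
  have hpos := expSemiAxes_pos hc₀ ψ
  refine ⟨fun x hx => memℓp_of_mem_ellipsoid hpos (summable_expSemiAxes hψ hc₀) hx,
    fun ε hε => ?_, ?_⟩
  · obtain ⟨C, hC⟩ := exists_metricEntropy_le 𝕜
    obtain ⟨s, hs, htail⟩ := exists_forall_sum_expSemiAxes_le hψ hc₀ (by positivity : 0 < ε / 4)
    exact (hC p q _ hpos s hs ε hε htail).1
  set L : ℝ → ℝ := fun ε => Real.logb 2 ε⁻¹ + Real.logb 2 c₀ with hL
  have hLlim : Filter.Tendsto L (𝓝[>] 0) Filter.atTop :=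
    Filter.tendsto_atTop_add_const_right _ _
      ((Real.tendsto_logb_atTop one_lt_two).comp tendsto_inv_nhdsGT_zero)
  have htlim := hψ.tendsto_decayInv.comp hLlim
  -- The maximum matters only when `L ε ≤ 0`, where `decayInv` has no meaning.
  set d : ℝ → ℕ := fun ε => max 1 ⌈decayInv ψ tstar (L ε)⌉₊ with hd
  have hd1 : ∀ ε, 1 ≤ d ε := fun ε => le_max_left _ _
  have hdle : ∀ ε, 0 < L ε → decayInv ψ tstar (L ε) ≤ d ε ∧
      (d ε : ℝ) - 1 < decayInv ψ tstar (L ε) := fun ε hε => by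
    have ht0 : 0 < decayInv ψ tstar (L ε) := hψ.nonneg.trans_lt (hψ.decayInv_spec hε).1
    have h1 : d ε = ⌈decayInv ψ tstar (L ε)⌉₊ := max_eq_right (Nat.ceil_pos.mpr ht0)
    rw [h1]
    exact ⟨Nat.le_ceil _, by linarith [Nat.ceil_lt_add_one ht0.le]⟩
  refine ⟨d, fun ε _ => hd1 ε, ?_, ?_⟩
  · refine Asymptotics.IsBigO.of_bound 1 ?_
    filter_upwards [hLlim.eventually_gt_atTop 0] with ε hε
    obtain ⟨h1, h2⟩ := hdle ε hε
    rw [Real.norm_eq_abs, norm_one, mul_one, abs_le]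
    constructor <;> linarith
  -- `R` is the residual, so the identity holds for all `ε > 0` and the content is its bound.
  refine ⟨fun ε => metricEntropy ε (ellipsoidIn 𝕜 p q (expSemiAxes c₀ ψ)) / sigmaDim 𝕜 (d ε) -
    psiAverage ψ (d ε) - ((q⁻¹).toReal - (p⁻¹).toReal) * Real.logb 2 (sigmaDim 𝕜 (d ε)), ?_,
    fun ε _ => ?_⟩
  · obtain ⟨C, N, hC⟩ := exists_abs_metricEntropy_div_sub_le 𝕜 p q hψ hc₀
    refine Asymptotics.IsBigO.of_bound C ?_
    -- The inverse must exceed `tstar + 1` so that `d ε - 1` lies in `(tstar, ∞)`, where `ψ` is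
    -- monotone.
    filter_upwards [hLlim.eventually_gt_atTop 0, htlim.eventually_ge_atTop (N : ℝ),
      htlim.eventually_gt_atTop (tstar + 1), self_mem_nhdsWithin] with ε hε hεN hεt hε0
    obtain ⟨h1, h2⟩ := hdle ε hε
    obtain ⟨h3, h4⟩ := hψ.decayInv_spec hε
    simp only [Function.comp_apply] at hεN hεt
    refine hC (d ε) (by exact_mod_cast hεN.trans h1) ε hε0 ?_ ?_
    · have h5 : ψ ((d ε : ℝ) - 1) ≤ ψ (decayInv ψ tstar (L ε)) :=
        hψ.strictMonoOn.monotoneOn (by rw [Set.mem_Ioi]; linarith) h3 h2.le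
      exact h5.trans_eq h4
    · have h5 : ψ (decayInv ψ tstar (L ε)) ≤ ψ (d ε) :=
        hψ.strictMonoOn.monotoneOn h3 (h3.trans_le h1) h1
      exact h4.symm.trans_le h5
  · have hσ : (sigmaDim 𝕜 (d ε) : ℝ) ≠ 0 := by
      have := Nat.mul_pos (finrank_real_rclike_pos 𝕜) (hd1 ε)
      rw [sigmaDim]
      exact_mod_cast this.ne'
    field_simp
    ring
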